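/- **Setting.** Let $U,V\in L^\infty(\mathbb R)$ be real-valued functions with compact support, and let $\alpha_\lambda>0$ for every $\lambda>0$. In $L^2(\mathbb R)$ consider the Schrödinger operators $$H_0=-\frac{d^2}{dx^2}+U(x),\qquad H_\lambda=-\frac{d^2}{dx^2}+U(x)+\lambda\alpha_\lambda V(\alpha_\lambda x)\quad(\lambda>0)$$ with domain the Sobolev space $W_2^2(\mathbb R)$. Suppose that $H_0$ has a zero-energy resonance, that is, the equation $-h''+Uh=0$ has a nontrivial solution $h$ that is bounded on $\mathbb R$. Such an $h$ has finite nonzero limits $h_\pm$ at $\pm\infty$. Let $u=h/h_-$ be the normalized half-bound state, so that $\lim_{x\to-\infty}u(x)=1$, and let $\theta=\lim_{x\to+\infty}u(x)$. **Theorem.** Assume that one of the following conditions holds as $\lambda\to0+$, and define $k$ accordingly: * (i) $\alpha_\lambda\to\alpha$ for some $\alpha>0$ and $\int_{\mathbb R}V(\alpha x)u^2(x)\,dx<0$; then set $k=\dfrac{\alpha}{\theta^2+1}\displaystyle\int_{\mathbb R}V(\alpha x)u^2(x)\,dx$; * (ii) $\alpha_\lambda\to+\infty$, $u(0)\neq0$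 and $\int_{\mathbb R}V\,dx<0$; then set $k=\dfrac{u^2(0)}{\theta^2+1}\displaystyle\int_{\mathbb R}V\,dx$; * (iii) $\alpha_\lambda\to0$, $\lambda/\alpha_\lambda\to0$ and $\int_{\mathbb R_-}V\,dx+\theta^2\int_{\mathbb R_+}V\,dx<0$; then set $k=\dfrac{1}{\theta^2+1}\displaystyle\int_{\mathbb R_-}V\,dx+\dfrac{\theta^2}{\theta^2+1}\int_{\mathbb R_+}V\,dx$. Then $\lambda=0$ is a coupling constant threshold for $H_\lambda$, i.e. for all small positive $\lambda$ there is a negative eigenvalue $e_\lambda$ of $H_\lambda$ such that $e_\lambda\to0$ as $\lambda\to0+$; moreover $$e_\lambda=-\lambda^2\bigl(k^2+o(1)\bigr)\qquad\text{as }\lambda\to0+.$$ -/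

import Mathlib

open MeasureTheory Filter Topology Asymptotics
open scoped ContDiff


namespace Threshold

/-- The complex Hilbert space `L²(ℝ)`. -/
abbrev L2 : Type := Lp ℂ 2 (volume : Measure ℝ)

/-- `g` is the weak (distributional) derivative of `f` on `ℝ`. -/
def HasWeakDeriv (f g : ℝ → ℂ) : Prop :=
  LocallyIntegrable f ∧ LocallyIntegrable g ∧
    ∀ φ : ℝ → ℝ, ContDiff ℝ ∞ φ → HasCompactSupport φ →
      ∫ x, deriv φ x • f x = -∫ x, φ x • g x

theorem integrable_test {f : ℝ → ℂ} (hf : LocallyIntegrable f) {φ : ℝ → ℝ}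
    (hφ : ContDiff ℝ ∞ φ) (hc : HasCompactSupport φ) : Integrable (fun x => φ x • f x) :=
  hf.integrable_smul_left_of_hasCompactSupport hφ.continuous hc

theorem integrable_deriv_test {f : ℝ → ℂ} (hf : LocallyIntegrable f) {φ : ℝ → ℝ}
    (hφ : ContDiff ℝ ∞ φ) (hc : HasCompactSupport φ) : Integrable (fun x => deriv φ x • f x) :=
  hf.integrable_smul_left_of_hasCompactSupport (hφ.continuous_deriv (by simp)) hc.deriv

theorem HasWeakDeriv.congr {f f' g g' : ℝ → ℂ} (h : HasWeakDeriv f g)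
    (hf : f =ᵐ[volume] f') (hg : g =ᵐ[volume] g') : HasWeakDeriv f' g' := by
  refine ⟨h.1.congr hf, h.2.1.congr hg, fun φ hφ hc => ?_⟩
  have e1 : ∫ x, deriv φ x • f x = ∫ x, deriv φ x • f' x :=
    integral_congr_ae (hf.mono fun x hx => by simp [hx])
  have e2 : ∫ x, φ x • g x = ∫ x, φ x • g' x :=
    integral_congr_ae (hg.mono fun x hx => by simp [hx])
  rw [← e1, ← e2]
  exact h.2.2 φ hφ hc

theorem HasWeakDeriv.add {f f' g g' : ℝ → ℂ} (h : HasWeakDeriv f g)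
    (h' : HasWeakDeriv f' g') : HasWeakDeriv (f + f') (g + g') := by
  refine ⟨h.1.add h'.1, h.2.1.add h'.2.1, fun φ hφ hc => ?_⟩
  simp only [Pi.add_apply, smul_add]
  rw [integral_add (integrable_deriv_test h.1 hφ hc) (integrable_deriv_test h'.1 hφ hc),
    integral_add (integrable_test h.2.1 hφ hc) (integrable_test h'.2.1 hφ hc),
    h.2.2 φ hφ hc, h'.2.2 φ hφ hc, neg_add]

theorem HasWeakDeriv.smul (c : ℂ) {f g : ℝ → ℂ} (h : HasWeakDeriv f g) :
    HasWeakDeriv (c • f) (c • g) := by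
  refine ⟨h.1.smul c, h.2.1.smul c, fun φ hφ hc => ?_⟩
  simp only [Pi.smul_apply, smul_comm _ c]
  rw [integral_smul, integral_smul, h.2.2 φ hφ hc, smul_neg]

theorem HasWeakDeriv.unique {f g g' : ℝ → ℂ} (h : HasWeakDeriv f g)
    (h' : HasWeakDeriv f g') : g =ᵐ[volume] g' :=
  ae_eq_of_integral_contDiff_smul_eq h.2.1 h'.2.1 fun φ hφ hc =>
    neg_injective ((h.2.2 φ hφ hc).symm.trans (h'.2.2 φ hφ hc))

/-- `f'' = g` weakly, where `f`, `f'` and `g` all belong to `L²(ℝ)`. -/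
def HasSecondDeriv (f g : L2) : Prop :=
  ∃ f₁ : L2, HasWeakDeriv f f₁ ∧ HasWeakDeriv f₁ g

theorem HasSecondDeriv.add {f f' g g' : L2} (h : HasSecondDeriv f g)
    (h' : HasSecondDeriv f' g') : HasSecondDeriv (f + f') (g + g') := by
  obtain ⟨p, h1, h2⟩ := h
  obtain ⟨p', h1', h2'⟩ := h'
  exact ⟨p + p', (h1.add h1').congr (Lp.coeFn_add _ _).symm (Lp.coeFn_add _ _).symm,
    (h2.add h2').congr (Lp.coeFn_add _ _).symm (Lp.coeFn_add _ _).symm⟩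

theorem HasSecondDeriv.smul (c : ℂ) {f g : L2} (h : HasSecondDeriv f g) :
    HasSecondDeriv (c • f) (c • g) := by
  obtain ⟨p, h1, h2⟩ := h
  exact ⟨c • p, (h1.smul c).congr (Lp.coeFn_smul _ _).symm (Lp.coeFn_smul _ _).symm,
    (h2.smul c).congr (Lp.coeFn_smul _ _).symm (Lp.coeFn_smul _ _).symm⟩

theorem HasSecondDeriv.unique {f g g' : L2} (h : HasSecondDeriv f g)
    (h' : HasSecondDeriv f g') : g = g' := by
  obtain ⟨p, h1, h2⟩ := h
  obtain ⟨p', h1', h2'⟩ := h'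
  have hp : p = p' := Lp.ext (h1.unique h1')
  subst hp
  exact Lp.ext (h2.unique h2')

theorem hasSecondDeriv_zero : HasSecondDeriv 0 0 := by
  have h : HasWeakDeriv (0 : ℝ → ℂ) 0 :=
    ⟨locallyIntegrable_zero, locallyIntegrable_zero, fun φ _ _ => by simp⟩
  exact ⟨0, h.congr (Lp.coeFn_zero _ _ _).symm (Lp.coeFn_zero _ _ _).symm,
    h.congr (Lp.coeFn_zero _ _ _).symm (Lp.coeFn_zero _ _ _).symm⟩

/-- The Sobolev space `W₂²(ℝ)`: functions in `L²(ℝ)` whose weak derivatives of order one and two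
belong to `L²(ℝ)`. -/
def W22 : Submodule ℂ L2 where
  carrier := {f | ∃ g : L2, HasSecondDeriv f g}
  zero_mem' := ⟨0, hasSecondDeriv_zero⟩
  add_mem' := fun ⟨g, h⟩ ⟨g', h'⟩ => ⟨g + g', h.add h'⟩
  smul_mem' := fun c _ ⟨g, h⟩ => ⟨c • g, h.smul c⟩

/-- The second weak derivative of a function in `W₂²(ℝ)`. -/
noncomputable def secondDeriv : W22 →ₗ[ℂ] L2 where
  toFun f := f.2.choose
  map_add' f g :=
    (f + g).2.choose_spec.unique (f.2.choose_spec.add g.2.choose_spec)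
  map_smul' c f := (c • f).2.choose_spec.unique (f.2.choose_spec.smul c)

/-- The maximal domain of multiplication by the real potential `W` in `L²(ℝ)`; it is the whole
space if `W` is bounded. -/
def mulDomain (W : ℝ → ℝ) : Submodule ℂ L2 where
  carrier := {f | MemLp (fun x => (W x : ℂ) * f x) 2 volume}
  zero_mem' := by
    have h0 : MemLp (fun _ : ℝ => (0 : ℂ)) 2 volume := MemLp.zero
    refine (memLp_congr_ae ?_).2 h0
    filter_upwards [Lp.coeFn_zero ℂ 2 (volume : Measure ℝ)] with x hx
    rw [hx, Pi.zero_apply, mul_zero]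
  add_mem' := by
    intro f g hf hg
    refine (memLp_congr_ae ?_).2 (MemLp.add hf hg)
    filter_upwards [Lp.coeFn_add f g] with x hx
    rw [hx, Pi.add_apply, Pi.add_apply, mul_add]
  smul_mem' := by
    intro c f hf
    refine (memLp_congr_ae ?_).2 (MemLp.const_smul hf c)
    filter_upwards [Lp.coeFn_smul c f] with x hx
    rw [hx, Pi.smul_apply, Pi.smul_apply, smul_eq_mul, smul_eq_mul, mul_left_comm]

theorem mulDomain_eq_top {W : ℝ → ℝ} (hW : MemLp W ⊤ volume) : mulDomain W = ⊤ := by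
  refine eq_top_iff.2 fun f _ => ?_
  exact MemLp.mul' (Lp.memLp f) hW.ofReal

/-- Multiplication by the real potential `W`. -/
noncomputable def mulPotential (W : ℝ → ℝ) : mulDomain W →ₗ[ℂ] L2 where
  toFun f := MemLp.toLp (fun x => (W x : ℂ) * (f : L2) x) f.2
  map_add' f g := by
    refine Lp.ext ?_
    refine (MemLp.coeFn_toLp _).trans ?_
    filter_upwards [Lp.coeFn_add (f : L2) (g : L2), MemLp.coeFn_toLp f.2, MemLp.coeFn_toLp g.2,
      Lp.coeFn_add (MemLp.toLp _ f.2) (MemLp.toLp _ g.2)] with x h1 h2 h3 h4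
    rw [h4, Pi.add_apply, h2, h3, Submodule.coe_add, h1, Pi.add_apply, mul_add]
  map_smul' c f := by
    refine Lp.ext ?_
    refine (MemLp.coeFn_toLp _).trans ?_
    filter_upwards [Lp.coeFn_smul c (f : L2), MemLp.coeFn_toLp f.2,
      Lp.coeFn_smul c (MemLp.toLp _ f.2)] with x h1 h2 h3
    rw [RingHom.id_apply, h3, Pi.smul_apply, h2, Submodule.coe_smul, h1, Pi.smul_apply,
      smul_eq_mul, smul_eq_mul, mul_left_comm]

/-- The Schrödinger operator `-d²/dx² + W` in `L²(ℝ)`, as an unbounded operator. -/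
noncomputable def schrodinger (W : ℝ → ℝ) : L2 →ₗ.[ℂ] L2 where
  domain := W22 ⊓ mulDomain W
  toFun := -(secondDeriv ∘ₗ Submodule.inclusion inf_le_left) +
    mulPotential W ∘ₗ Submodule.inclusion inf_le_right

/-- For a bounded potential the domain of the Schrödinger operator is `W₂²(ℝ)`. -/
theorem schrodinger_domain {W : ℝ → ℝ} (hW : MemLp W ⊤ volume) :
    (schrodinger W).domain = W22 := by
  change W22 ⊓ mulDomain W = W22
  rw [mulDomain_eq_top hW, inf_top_eq]

/-- `E` is an eigenvalue of the unbounded operator `A`. -/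
def IsEigenvalue (A : L2 →ₗ.[ℂ] L2) (E : ℂ) : Prop :=
  ∃ ψ : A.domain, (ψ : L2) ≠ 0 ∧ A ψ = E • (ψ : L2)

/-- `H_l = -d²/dx² + U + l α_l V(α_l ·)`. -/
noncomputable def hamiltonian (U V : ℝ → ℝ) (α : ℝ → ℝ) (l : ℝ) : L2 →ₗ.[ℂ] L2 :=
  schrodinger fun x => U x + l * α l * V (α l * x)

/-- `h` solves `-h'' + U h = 0` on `ℝ`: it is differentiable, its derivative is locally absolutely
continuous, and the equation holds almost everywhere. -/
def IsZeroEnergySolution (U h : ℝ → ℝ) : Prop :=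
  Differentiable ℝ h ∧ (∀ a b, AbsolutelyContinuousOnInterval (deriv h) a b) ∧
    ∀ᵐ x, -deriv (deriv h) x + U x * h x = 0

/-- `h` is a half-bound state of `-d²/dx² + U`: a nontrivial solution of `-h'' + U h = 0` that is
bounded on the whole line. -/
def IsHalfBoundState (U h : ℝ → ℝ) : Prop :=
  IsZeroEnergySolution U h ∧ h ≠ 0 ∧ ∃ C, ∀ x, |h x| ≤ C

/-- A half-bound state is normalized if its limit at `-∞` is `1`. -/
def IsNormalizedHalfBoundState (U u : ℝ → ℝ) : Prop :=
  IsHalfBoundState U u ∧ Tendsto u atBot (𝓝 1)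

/-- `e` is a branch of threshold eigenvalues of the family `H`: for all small positive `l` the
number `e l` is a negative eigenvalue of `H l`, and `e l → 0` as `l → 0`. -/
def IsThresholdEigenvalue (H : ℝ → L2 →ₗ.[ℂ] L2) (e : ℝ → ℝ) : Prop :=
  (∀ᶠ l in 𝓝[>] (0 : ℝ), e l < 0 ∧ IsEigenvalue (H l) (e l)) ∧ Tendsto e (𝓝[>] 0) (𝓝 0)

/-- `e l = -l² (k² + o(1))` as `l → 0+`. -/
def HasThresholdAsymptotics (e : ℝ → ℝ) (k : ℝ) : Prop :=
  ∃ r : ℝ → ℝ, Tendsto r (𝓝[>] 0) (𝓝 0) ∧ ∀ᶠ l in 𝓝[>] (0 : ℝ), e l = -l ^ 2 * (k ^ 2 + r l)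

end Threshold

/-!
The eigenvalues are found by shooting from the half-bound state. Let `u` be the normalized half-bound
state and `v` the second zero-energy solution with Wronskian `u v' - u' v = 1`; outside the support of
`U` the function `u` is constant (`1` on the left, `θ` on the right) while `v` grows linearly. Since
`θ v' = 1` to the right of the support, `θ` does not vanish.

Write `-κ²` for the sought eigenvalue, `q = λ α V(α ·)`, and choose `R` such that `U` and `q` vanish
outside `[-R, R]`. The solution `ψ` of `-ψ'' + (U + q + κ²) ψ = 0` that continues `e^{κ(x + R)}` from
the left satisfies, by variation of constants, a Volterra equation with kernel
`(v(x)u(t) - u(x)v(t)) (q(t) + κ²)`. It decays on the right exactly if `ψ'(R) + κ ψ(R) = 0`, and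
pairing the equation with `u` turns this condition into
`Φ(κ) = κ + ∫ (q + κ²) u ψ + κ θ ψ(R) = 0`.

With `κ = λ s` the kernel has size `R` and `∫ |q + κ²|` has size `λ`, so the Volterra operator has
norm of order `λR`. As `R` may be taken to be `r + ρ/α`, this tends to zero in all three regimes, and
then `ψ` is uniformly close to `u` on `[-R, R]`. Hence
`Φ(λ s)/λ → s (1 + θ²) + L`, where `L = lim ∫ α V(α x) u(x)² dx = lim ∫ V(y) u(y/α)² dy`. Since `L < 0`
and `Φ` is continuous, the intermediate value theorem gives a zero with `s` arbitrarily close to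
`-L/(1 + θ²)`. The value of `L` in each regime follows by dominated convergence.

The estimates are in `IsResonantSystem.exists_shooting_family` and
`IsResonantSystem.abs_shootingValue_sub_le`, the eigenfunction is built in
`IsResonantSystem.isEigenvalue_of_shootingValue_eq_zero`, and the three regimes meet in
`exists_thresholdEigenvalue`. The coefficients are only locally integrable, so differential equations
are used in integrated form throughout, by means of `IsPrimitive`.
-/

namespace Threshold

/-! ### Primitives of locally integrable functions -/

/-- `F` is a primitive of the locally integrable function `f`. Equivalently, `F` is locally
absolutely continuous with derivative `f` almost everywhere; the integral form is the one that
composes well. -/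
structure IsPrimitive (F f : ℝ → ℝ) : Prop where
  locallyIntegrable : LocallyIntegrable f
  integral_eq : ∀ a b, ∫ x in a..b, f x = F b - F a

theorem intervalIntegrable_of_locallyIntegrable {f : ℝ → ℝ} (hf : LocallyIntegrable f)
    (a b : ℝ) : IntervalIntegrable f volume a b :=
  (hf.integrableOn_isCompact isCompact_uIcc).intervalIntegrable

theorem locallyIntegrable_mul_continuous {f g : ℝ → ℝ} (hf : LocallyIntegrable f)
    (hg : Continuous g) : LocallyIntegrable fun x => f x * g x := by
  refine (locallyIntegrable_iff).2 fun K hK => ?_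
  exact (hf.integrableOn_isCompact hK).mul_continuousOn hg.continuousOn hK

theorem isPrimitive_integral {f : ℝ → ℝ} (hf : LocallyIntegrable f) (c a : ℝ) :
    IsPrimitive (fun x => c + ∫ t in a..x, f t) f := by
  refine ⟨hf, fun x y => ?_⟩
  have := intervalIntegral.integral_add_adjacent_intervals
    (intervalIntegrable_of_locallyIntegrable hf a x)
    (intervalIntegrable_of_locallyIntegrable hf x y)
  linarith

theorem isPrimitive_of_hasDerivAt {F f : ℝ → ℝ} (h : ∀ x, HasDerivAt F (f x) x)
    (hf : Continuous f) : IsPrimitive F f :=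
  ⟨hf.locallyIntegrable, fun a b => intervalIntegral.integral_eq_sub_of_hasDerivAt
    (fun x _ => h x) (hf.intervalIntegrable a b)⟩

namespace IsPrimitive

variable {F G f g : ℝ → ℝ}

theorem intervalIntegrable (h : IsPrimitive F f) (a b : ℝ) : IntervalIntegrable f volume a b :=
  intervalIntegrable_of_locallyIntegrable h.locallyIntegrable a b

theorem eq_add_integral (h : IsPrimitive F f) (a : ℝ) :
    F = fun x => F a + ∫ t in a..x, f t := by
  funext x
  rw [h.integral_eq]
  ring

theorem continuous (h : IsPrimitive F f) : Continuous F := by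
  rw [h.eq_add_integral 0]
  exact continuous_const.add (intervalIntegral.continuous_primitive h.intervalIntegrable 0)

theorem absolutelyContinuous (h : IsPrimitive F f) (a b : ℝ) :
    AbsolutelyContinuousOnInterval F a b := by
  have h1 := (h.intervalIntegrable a b).absolutelyContinuousOnInterval_intervalIntegral
    (c := a) (by simp)
  have h2 : AbsolutelyContinuousOnInterval (fun _ : ℝ => F a) a b :=
    (contDiff_const (n := 1)).contDiffOn.absolutelyContinuousOnInterval
  rw [h.eq_add_integral a]
  exact h2.add h1

theorem ae_deriv_eq (h : IsPrimitive F f) : ∀ᵐ x, deriv F x = f x := by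
  filter_upwards [_root_.LocallyIntegrable.ae_hasDerivAt_integral h.locallyIntegrable] with x hx
  have h1 := (hx 0).const_add (F 0)
  rw [← h.eq_add_integral 0] at h1
  exact h1.deriv

theorem congr (h : IsPrimitive F f) (hfg : ∀ x, f x = g x) : IsPrimitive F g := by
  have : f = g := funext hfg
  exact this ▸ h

theorem add (h : IsPrimitive F f) (h' : IsPrimitive G g) :
    IsPrimitive (fun x => F x + G x) (fun x => f x + g x) := by
  refine ⟨h.locallyIntegrable.add h'.locallyIntegrable, fun a b => ?_⟩
  rw [intervalIntegral.integral_add (h.intervalIntegrable a b) (h'.intervalIntegrable a b),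
    h.integral_eq, h'.integral_eq]
  ring

theorem neg (h : IsPrimitive F f) : IsPrimitive (fun x => -F x) (fun x => -f x) := by
  refine ⟨h.locallyIntegrable.neg, fun a b => ?_⟩
  rw [intervalIntegral.integral_neg, h.integral_eq]
  ring

theorem mul (h : IsPrimitive F f) (h' : IsPrimitive G g) :
    IsPrimitive (fun x => F x * G x) (fun x => f x * G x + F x * g x) := by
  refine ⟨(locallyIntegrable_mul_continuous h.locallyIntegrable h'.continuous).add ?_,
    fun a b => ?_⟩
  · simpa only [mul_comm] using locallyIntegrable_mul_continuous h'.locallyIntegrable h.continuous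
  · rw [← (h.absolutelyContinuous a b).integral_deriv_mul_eq_sub (h'.absolutelyContinuous a b)]
    refine intervalIntegral.integral_congr_ae ?_
    filter_upwards [h.ae_deriv_eq, h'.ae_deriv_eq] with x h1 h2 _
    rw [h1, h2]

theorem eq_of_eqOn_zero (h : IsPrimitive F f) {a b : ℝ} (hf : ∀ x ∈ Set.uIcc a b, f x = 0) :
    F a = F b := by
  have h1 := h.integral_eq a b
  rw [intervalIntegral.integral_congr (g := fun _ => (0 : ℝ)) hf, intervalIntegral.integral_zero]
    at h1
  linarith

/-- Integration by parts against a test function: a primitive has `f` as its weak derivative. -/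
theorem hasWeakDeriv (h : IsPrimitive F f) :
    HasWeakDeriv (fun x => (F x : ℂ)) (fun x => (f x : ℂ)) := by
  have hF : LocallyIntegrable fun x => (F x : ℂ) :=
    (Complex.continuous_ofReal.comp h.continuous).locallyIntegrable
  have hf : LocallyIntegrable fun x => (f x : ℂ) := by
    refine (locallyIntegrable_iff).2 fun K hK => ?_
    exact (h.locallyIntegrable.integrableOn_isCompact hK).ofReal
  refine ⟨hF, hf, fun φ hφ hc => ?_⟩
  have hdφ : Continuous (deriv φ) := hφ.continuous_deriv (by simp)
  have hp : IsPrimitive φ (deriv φ) :=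
    isPrimitive_of_hasDerivAt (fun x => (hφ.differentiable (by simp) x).hasDerivAt) hdφ
  have hm := hp.mul h
  obtain ⟨M, hM⟩ := hc.isCompact.isBounded.subset_closedBall 0
  have hz : ∀ x, M < |x| → φ x = 0 := fun x hx => by
    by_contra h0
    have := hM (subset_tsupport _ h0)
    rw [Metric.mem_closedBall, dist_zero_right, Real.norm_eq_abs] at this
    linarith
  have i1 : Integrable fun x => deriv φ x * F x := by
    refine (hdφ.mul h.continuous).integrable_of_hasCompactSupport (hc.deriv.mul_right)
  have i2 : Integrable fun x => φ x * f x := by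
    simpa only [smul_eq_mul] using
      h.locallyIntegrable.integrable_smul_left_of_hasCompactSupport hφ.continuous hc
  have key : ∫ x, (deriv φ x * F x + φ x * f x) = 0 := by
    have ht := intervalIntegral_tendsto_integral (i1.add i2)
      tendsto_neg_atTop_atBot tendsto_id
    refine tendsto_nhds_unique ht ?_
    refine tendsto_const_nhds.congr' ?_
    filter_upwards [eventually_gt_atTop M, eventually_gt_atTop 0] with N hN hN0
    have h1 : M < |N| := hN.trans_le (le_abs_self N)
    have := hm.integral_eq (-N) N
    rw [hz N h1, hz (-N) (by rwa [abs_neg])] at this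
    simp only [id_eq, Pi.add_apply]
    rw [this]
    ring
  rw [integral_add i1 i2] at key
  have e1 : ∫ x, deriv φ x • (F x : ℂ) = ((∫ x, deriv φ x * F x : ℝ) : ℂ) := by
    rw [← integral_complex_ofReal]
    simp
  have e2 : ∫ x, φ x • (f x : ℂ) = ((∫ x, φ x * f x : ℝ) : ℂ) := by
    rw [← integral_complex_ofReal]
    simp
  rw [e1, e2, ← Complex.ofReal_neg]
  congr 1
  linarith

end IsPrimitive

/-! ### Volterra integral equations with a degenerate kernel -/

theorem continuous_iccExtend {a b : ℝ} (hab : a ≤ b) (f : C(Set.Icc a b, ℝ)) :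
    Continuous (Set.IccExtend hab f) :=
  f.continuous.Icc_extend'

/-- The bounded operator `f ↦ ∫ₐˣ h f` on `C([a, b])`, where `h` is locally integrable. -/
noncomputable def volterraPrimitive {a b : ℝ} (hab : a ≤ b) (h : ℝ → ℝ)
    (hh : LocallyIntegrable h) : C(Set.Icc a b, ℝ) →L[ℝ] C(Set.Icc a b, ℝ) :=
  have hi : ∀ f : C(Set.Icc a b, ℝ), ∀ c d,
      IntervalIntegrable (fun t => h t * Set.IccExtend hab f t) volume c d := fun f c d =>
    intervalIntegrable_of_locallyIntegrable
      (locallyIntegrable_mul_continuous hh (continuous_iccExtend hab f)) c d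
  LinearMap.mkContinuous
    { toFun := fun f => ⟨fun x => ∫ t in a..x, h t * Set.IccExtend hab f t,
        (intervalIntegral.continuous_primitive (hi f) a).comp continuous_subtype_val⟩
      map_add' := fun f g => by
        ext x
        simp only [ContinuousMap.coe_mk, ContinuousMap.add_apply]
        rw [← intervalIntegral.integral_add (hi f _ _) (hi g _ _)]
        refine intervalIntegral.integral_congr fun t _ => ?_
        simp only [Set.IccExtend, Function.comp_apply, ContinuousMap.add_apply]
        ring
      map_smul' := fun c f => by
        ext x
        simp only [ContinuousMap.coe_mk, ContinuousMap.smul_apply, smul_eq_mul, RingHom.id_apply]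
        rw [← intervalIntegral.integral_const_mul]
        refine intervalIntegral.integral_congr fun t _ => ?_
        simp only [Set.IccExtend, Function.comp_apply, ContinuousMap.smul_apply, smul_eq_mul]
        ring }
    (∫ t in a..b, |h t|) (fun f => by
      have hI := (intervalIntegrable_of_locallyIntegrable hh a b).abs
      have h0 : 0 ≤ ∫ t in a..b, |h t| :=
        intervalIntegral.integral_nonneg hab fun t _ => abs_nonneg _
      refine (ContinuousMap.norm_le _ (mul_nonneg h0 (norm_nonneg f))).2 fun x => ?_
      simp only [LinearMap.coe_mk, AddHom.coe_mk, ContinuousMap.coe_mk]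
      have hIx := (intervalIntegrable_of_locallyIntegrable hh a x).abs
      calc ‖∫ t in a..(x : ℝ), h t * Set.IccExtend hab f t‖
          ≤ ∫ t in a..(x : ℝ), |h t| * ‖f‖ := by
            refine intervalIntegral.norm_integral_le_of_norm_le x.2.1 ?_ (hIx.mul_const _)
            refine Eventually.of_forall fun t _ => ?_
            rw [norm_mul, Real.norm_eq_abs]
            exact mul_le_mul_of_nonneg_left (f.norm_coe_le_norm _) (abs_nonneg _)
        _ = (∫ t in a..(x : ℝ), |h t|) * ‖f‖ := intervalIntegral.integral_mul_const _ _
        _ ≤ (∫ t in a..b, |h t|) * ‖f‖ := by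
            refine mul_le_mul_of_nonneg_right ?_ (norm_nonneg _)
            exact intervalIntegral.integral_mono_interval le_rfl x.2.1 x.2.2
              (Eventually.of_forall fun t => abs_nonneg _) hI)

theorem volterraPrimitive_apply {a b : ℝ} (hab : a ≤ b) {h : ℝ → ℝ} (hh : LocallyIntegrable h)
    (f : C(Set.Icc a b, ℝ)) (x : Set.Icc a b) :
    volterraPrimitive hab h hh f x = ∫ t in a..x, h t * Set.IccExtend hab f t := rfl

/-- A Volterra equation with kernel `(g₁(x)h₁(t) + g₂(x)h₂(t)) (q(t) + κ²)` is solvable as soon as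
the kernel is small in the sense that `M ∫ |q + κ²| ≤ 1/2`, and its solution is continuous in `κ`.
It is obtained by inverting `1 - T(κ)` in the Banach algebra of operators on `C([a, b])`, where
`T(κ)` is a polynomial in `κ`. -/
theorem exists_volterra_family {a b : ℝ} (hab : a ≤ b) {g₁ h₁ g₂ h₂ q f₀ f₁ : ℝ → ℝ}
    (hg₁ : Continuous g₁) (hh₁ : Continuous h₁) (hg₂ : Continuous g₂) (hh₂ : Continuous h₂)
    (hq : LocallyIntegrable q) (hf₀ : Continuous f₀) (hf₁ : Continuous f₁) {M : ℝ}
    (hM : ∀ x t, a ≤ t → t ≤ x → x ≤ b → |g₁ x * h₁ t + g₂ x * h₂ t| ≤ M) :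
    ∃ ψ : ℝ → C(Set.Icc a b, ℝ),
      ContinuousOn ψ {κ | M * ∫ t in a..b, |q t + κ ^ 2| ≤ 1 / 2} ∧
      ∀ κ, M * ∫ t in a..b, |q t + κ ^ 2| ≤ 1 / 2 →
        (∀ x : Set.Icc a b, ψ κ x = f₀ x + κ * f₁ x +
          (g₁ x * (∫ t in a..x, (q t + κ ^ 2) * h₁ t * Set.IccExtend hab (ψ κ) t) +
            g₂ x * ∫ t in a..x, (q t + κ ^ 2) * h₂ t * Set.IccExtend hab (ψ κ) t)) ∧
        ∀ F, (∀ x ∈ Set.Icc a b, |f₀ x + κ * f₁ x| ≤ F) → ∀ x : Set.Icc a b,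
          |ψ κ x - (f₀ x + κ * f₁ x)| ≤ (M * ∫ t in a..b, |q t + κ ^ 2|) * (2 * F) := by
  have hM0 : 0 ≤ M := (abs_nonneg _).trans (hM a a le_rfl le_rfl hab)
  let G₁ : C(Set.Icc a b, ℝ) := ⟨fun x => g₁ x, hg₁.comp continuous_subtype_val⟩
  let G₂ : C(Set.Icc a b, ℝ) := ⟨fun x => g₂ x, hg₂.comp continuous_subtype_val⟩
  let F₀ : C(Set.Icc a b, ℝ) := ⟨fun x => f₀ x, hf₀.comp continuous_subtype_val⟩
  let F₁ : C(Set.Icc a b, ℝ) := ⟨fun x => f₁ x, hf₁.comp continuous_subtype_val⟩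
  have l₁ := locallyIntegrable_mul_continuous hq hh₁
  have l₂ := locallyIntegrable_mul_continuous hq hh₂
  let A := ContinuousLinearMap.mul ℝ C(Set.Icc a b, ℝ)
  let T₀ : C(Set.Icc a b, ℝ) →L[ℝ] C(Set.Icc a b, ℝ) :=
    A G₁ ∘L volterraPrimitive hab _ l₁ + A G₂ ∘L volterraPrimitive hab _ l₂
  let T₁ : C(Set.Icc a b, ℝ) →L[ℝ] C(Set.Icc a b, ℝ) :=
    A G₁ ∘L volterraPrimitive hab _ hh₁.locallyIntegrable +
      A G₂ ∘L volterraPrimitive hab _ hh₂.locallyIntegrable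
  let T : ℝ → C(Set.Icc a b, ℝ) →L[ℝ] C(Set.Icc a b, ℝ) := fun κ => T₀ + κ ^ 2 • T₁
  have hint : ∀ h : ℝ → ℝ, Continuous h → ∀ κ (f : C(Set.Icc a b, ℝ)) (x : Set.Icc a b),
      (∫ t in a..x, q t * h t * Set.IccExtend hab f t) +
        κ ^ 2 * (∫ t in a..x, h t * Set.IccExtend hab f t) =
      ∫ t in a..x, (q t + κ ^ 2) * h t * Set.IccExtend hab f t := by
    intro h hh κ f x
    have hc := continuous_iccExtend hab f
    have i1 := intervalIntegrable_of_locallyIntegrable (locallyIntegrable_mul_continuous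
      (locallyIntegrable_mul_continuous hq hh) hc) a x
    have i2 : IntervalIntegrable (fun t => κ ^ 2 * (h t * Set.IccExtend hab f t)) volume a x :=
      (continuous_const.mul (hh.mul hc)).intervalIntegrable _ _
    rw [← intervalIntegral.integral_const_mul, ← intervalIntegral.integral_add i1 i2]
    refine intervalIntegral.integral_congr fun t _ => ?_
    ring
  have hT : ∀ κ f (x : Set.Icc a b), T κ f x =
      g₁ x * (∫ t in a..x, (q t + κ ^ 2) * h₁ t * Set.IccExtend hab f t) +
        g₂ x * ∫ t in a..x, (q t + κ ^ 2) * h₂ t * Set.IccExtend hab f t := by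
    intro κ f x
    rw [← hint h₁ hh₁, ← hint h₂ hh₂]
    simp only [T, T₀, T₁, A, add_apply, smul_apply,
      ContinuousLinearMap.comp_apply, ContinuousMap.add_apply, ContinuousMap.smul_apply,
      ContinuousLinearMap.mul_apply', ContinuousMap.mul_apply, volterraPrimitive_apply, G₁, G₂,
      ContinuousMap.coe_mk, smul_eq_mul]
    ring
  have hqk : ∀ κ : ℝ, LocallyIntegrable fun t => q t + κ ^ 2 := fun κ =>
    hq.add continuous_const.locallyIntegrable
  have hTn : ∀ κ, ‖T κ‖ ≤ M * ∫ t in a..b, |q t + κ ^ 2| := by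
    intro κ
    have hI := (intervalIntegrable_of_locallyIntegrable (hqk κ) a b).abs
    have h0 : 0 ≤ ∫ t in a..b, |q t + κ ^ 2| :=
      intervalIntegral.integral_nonneg hab fun t _ => abs_nonneg _
    refine ContinuousLinearMap.opNorm_le_bound _ (mul_nonneg hM0 h0) fun f => ?_
    refine (ContinuousMap.norm_le _ (by positivity)).2 fun x => ?_
    have hc := continuous_iccExtend hab f
    have i1 := intervalIntegrable_of_locallyIntegrable (locallyIntegrable_mul_continuous
      (locallyIntegrable_mul_continuous (hqk κ) hh₁) hc) a x
    have i2 := intervalIntegrable_of_locallyIntegrable (locallyIntegrable_mul_continuous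
      (locallyIntegrable_mul_continuous (hqk κ) hh₂) hc) a x
    have hIx := (intervalIntegrable_of_locallyIntegrable (hqk κ) a x).abs
    rw [hT, ← intervalIntegral.integral_const_mul, ← intervalIntegral.integral_const_mul,
      ← intervalIntegral.integral_add (i1.const_mul _) (i2.const_mul _)]
    calc _ ≤ ∫ t in a..(x : ℝ), M * |q t + κ ^ 2| * ‖f‖ := by
            refine intervalIntegral.norm_integral_le_of_norm_le x.2.1 ?_
              ((hIx.const_mul _).mul_const _)
            refine Eventually.of_forall fun t ht => ?_
            have e : g₁ x * ((q t + κ ^ 2) * h₁ t * Set.IccExtend hab f t) +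
                g₂ x * ((q t + κ ^ 2) * h₂ t * Set.IccExtend hab f t) =
                (g₁ x * h₁ t + g₂ x * h₂ t) * (q t + κ ^ 2) * Set.IccExtend hab f t := by ring
            rw [e, norm_mul, norm_mul, Real.norm_eq_abs, Real.norm_eq_abs]
            have b1 := hM x t ht.1.le ht.2 x.2.2
            have b2 : ‖Set.IccExtend hab f t‖ ≤ ‖f‖ := f.norm_coe_le_norm _
            gcongr
      _ = M * (∫ t in a..(x : ℝ), |q t + κ ^ 2|) * ‖f‖ := by
            rw [intervalIntegral.integral_mul_const, intervalIntegral.integral_const_mul]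
      _ ≤ M * (∫ t in a..b, |q t + κ ^ 2|) * ‖f‖ := by
            have := intervalIntegral.integral_mono_interval le_rfl x.2.1 x.2.2
              (Eventually.of_forall fun t => abs_nonneg _) hI
            gcongr
  have hlt : ∀ κ, M * ∫ t in a..b, |q t + κ ^ 2| ≤ 1 / 2 → ‖T κ‖ < 1 := fun κ hκ => by
    linarith [hTn κ]
  refine ⟨fun κ => Ring.inverse (1 - T κ) (F₀ + κ • F₁), ?_, fun κ hκ => ?_⟩
  · intro κ hκ
    refine ContinuousAt.continuousWithinAt ?_
    have hTc : ContinuousAt (fun κ => 1 - T κ) κ := by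
      refine Continuous.continuousAt ?_
      exact continuous_const.sub (continuous_const.add ((continuous_pow 2).smul continuous_const))
    have hinv : ContinuousAt (fun κ => Ring.inverse (1 - T κ)) κ := by
      exact ContinuousAt.comp (f := fun κ => 1 - T κ)
        (NormedRing.inverse_continuousAt (Units.oneSub (T κ) (hlt κ hκ))) hTc
    have hfc : ContinuousAt (fun κ : ℝ => F₀ + κ • F₁) κ :=
      (continuous_const.add (continuous_id.smul continuous_const)).continuousAt
    exact hinv.clm_apply hfc
  · set ψ := Ring.inverse (1 - T κ) (F₀ + κ • F₁) with hψ
    have hfix : ψ = F₀ + κ • F₁ + T κ ψ := by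
      have h1 : ((1 - T κ) * Ring.inverse (1 - T κ)) (F₀ + κ • F₁) = F₀ + κ • F₁ := by
        have hu : IsUnit (1 - T κ) := (Units.oneSub (T κ) (hlt κ hκ)).isUnit
        rw [Ring.mul_inverse_cancel _ hu]
        rfl
      rw [mul_apply_eq_comp, ← hψ] at h1
      rw [← h1]
      simp
    refine ⟨fun x => ?_, fun F hF x => ?_⟩
    · change ψ x = _
      conv_lhs => rw [hfix]
      rw [ContinuousMap.add_apply, hT]
      rfl
    · have hF0 : 0 ≤ F := (abs_nonneg _).trans (hF a ⟨le_rfl, hab⟩)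
      change |ψ x - _| ≤ _
      have h1 : ‖F₀ + κ • F₁‖ ≤ F := (ContinuousMap.norm_le _ hF0).2 fun x => hF x x.2
      have h2 : ‖ψ‖ ≤ F + 1 / 2 * ‖ψ‖ := by
        conv_lhs => rw [hfix]
        refine (norm_add_le _ _).trans (add_le_add h1 ?_)
        refine ((T κ).le_opNorm ψ).trans ?_
        exact mul_le_mul_of_nonneg_right ((hTn κ).trans hκ) (norm_nonneg _)
      have h3 : ψ x - (f₀ x + κ * f₁ x) = T κ ψ x := by
        conv_lhs => rw [hfix]
        exact add_sub_cancel_left _ _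
      rw [h3]
      refine ((T κ ψ).norm_coe_le_norm x).trans (((T κ).le_opNorm ψ).trans ?_)
      exact mul_le_mul (hTn κ) (by linarith) (norm_nonneg _) ((norm_nonneg (T κ)).trans (hTn κ))

/-! ### Zero-energy solutions -/

/-- A second, linearly growing zero-energy solution `v`, equal to `x + r` to the left of the
support of `U`. The substitution `v = e^{mx} ψ` with `m` large turns the initial value problem
into a Volterra equation with a small kernel. -/
theorem exists_growing_solution {U : ℝ → ℝ} (hU : LocallyIntegrable U) {r : ℝ} (hr : 0 < r)
    (hUr : ∀ x, r ≤ |x| → U x = 0) :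
    ∃ (v p : ℝ → ℝ) (C : ℝ), IsPrimitive v p ∧ IsPrimitive p (fun x => U x * v x) ∧
      (∀ x ≤ -r, v x = x + r) ∧ (∀ x ≤ -r, p x = 1) ∧ 0 ≤ C ∧ ∀ x, |v x| ≤ C * |x + r| := by
  have hab : -r ≤ r := by linarith
  set N := ∫ t in (-r)..r, |U t| with hN
  have hN0 : 0 ≤ N := intervalIntegral.integral_nonneg hab fun t _ => abs_nonneg _
  set m := 2 * N + 1 with hm
  have hm0 : 0 < m := by linarith
  -- The kernel is `τ e^{-mτ} ≤ 1/m` with `τ = x - t`.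
  have hker : ∀ x t, -r ≤ t → t ≤ x → x ≤ r →
      |x * Real.exp (-(m * x)) * Real.exp (m * t) +
        -Real.exp (-(m * x)) * (t * Real.exp (m * t))| ≤ 1 / m := by
    intro x t _ htx _
    have e : x * Real.exp (-(m * x)) * Real.exp (m * t) +
        -Real.exp (-(m * x)) * (t * Real.exp (m * t)) =
        (x - t) * Real.exp (-(m * (x - t))) := by
      have : -(m * (x - t)) = -(m * x) + m * t := by ring
      rw [this, Real.exp_add]
      ring
    rw [e, abs_of_nonneg (mul_nonneg (by linarith) (Real.exp_pos _).le), le_div_iff₀ hm0]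
    have h1 := Real.add_one_le_exp (m * (x - t))
    have h2 : Real.exp (m * (x - t)) * Real.exp (-(m * (x - t))) = 1 := by
      rw [← Real.exp_add]
      simp
    have h3 : m * (x - t) * Real.exp (-(m * (x - t))) ≤
        Real.exp (m * (x - t)) * Real.exp (-(m * (x - t))) :=
      mul_le_mul_of_nonneg_right (by linarith) (Real.exp_pos _).le
    rw [h2] at h3
    linarith
  obtain ⟨Ψ, -, hΨ⟩ := exists_volterra_family hab
    (g₁ := fun x => x * Real.exp (-(m * x))) (h₁ := fun t => Real.exp (m * t))
    (g₂ := fun x => -Real.exp (-(m * x))) (h₂ := fun t => t * Real.exp (m * t))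
    (f₀ := fun x => (x + r) * Real.exp (-(m * x))) (f₁ := fun _ => 0)
    (by fun_prop) (by fun_prop) (by fun_prop) (by fun_prop) hU (by fun_prop) (by fun_prop) hker
  have hsmall : 1 / m * ∫ t in (-r)..r, |U t + (0 : ℝ) ^ 2| ≤ 1 / 2 := by
    simp only [ne_eq, OfNat.ofNat_ne_zero, not_false_eq_true, zero_pow, add_zero]
    rw [← hN, div_mul_eq_mul_div, div_le_iff₀ hm0]
    linarith
  obtain ⟨hψ, -⟩ := hΨ 0 hsmall
  set ψ := Set.IccExtend hab (Ψ 0) with hψdef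
  have hψc : Continuous ψ := (Ψ 0).continuous.Icc_extend'
  -- Since `w` vanishes off the support of `U`, integrating it twice extends the solution to the line
  -- without case distinctions.
  set w : ℝ → ℝ := fun t => U t * (Real.exp (m * t) * ψ t) with hw
  have hwl : LocallyIntegrable w :=
    locallyIntegrable_mul_continuous hU (by fun_prop)
  have hp := isPrimitive_integral hwl 1 (-r)
  set p : ℝ → ℝ := fun x => 1 + ∫ t in (-r)..x, w t with hpdef
  have hv := isPrimitive_integral hp.continuous.locallyIntegrable 0 (-r)
  set v : ℝ → ℝ := fun x => 0 + ∫ t in (-r)..x, p t with hvdef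
  have hid : IsPrimitive (fun x : ℝ => x) (fun _ => 1) :=
    isPrimitive_of_hasDerivAt (fun x => hasDerivAt_id x) continuous_const
  have hvψ : ∀ x ∈ Set.Icc (-r) r, v x = Real.exp (m * x) * ψ x := by
    intro x hx
    have e1 : ψ x = Ψ 0 ⟨x, hx⟩ := Set.IccExtend_of_mem hab _ hx
    have e2 : Real.exp (m * x) * Real.exp (-(m * x)) = 1 := by
      rw [← Real.exp_add]
      simp
    have e3 := (hid.mul hp).integral_eq (-r) x
    have i1 : IntervalIntegrable (fun t => 1 * p t) volume (-r) x :=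
      (continuous_const.mul hp.continuous).intervalIntegrable _ _
    have i2 : IntervalIntegrable (fun t => t * w t) volume (-r) x := by
      simpa only [mul_comm, id_eq] using intervalIntegrable_of_locallyIntegrable
        (locallyIntegrable_mul_continuous hwl continuous_id) (-r) x
    rw [intervalIntegral.integral_add i1 i2] at e3
    have e4 : p (-r) = 1 := by simp [hpdef]
    have e5 : v x = ∫ t in (-r)..x, 1 * p t := by simp [hvdef]
    rw [e4, ← e5] at e3
    rw [e1, hψ ⟨x, hx⟩]
    have e6 : (∫ t in (-r)..x, (U t + (0 : ℝ) ^ 2) * Real.exp (m * t) * ψ t) =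
        ∫ t in (-r)..x, w t := by
      refine intervalIntegral.integral_congr fun t _ => ?_
      simp only [hw]
      ring
    have e7 : (∫ t in (-r)..x, (U t + (0 : ℝ) ^ 2) * (t * Real.exp (m * t)) * ψ t) =
        ∫ t in (-r)..x, t * w t := by
      refine intervalIntegral.integral_congr fun t _ => ?_
      simp only [hw]
      ring
    simp only [e6, e7]
    have e8 : p x = 1 + ∫ t in (-r)..x, w t := rfl
    rw [e8] at e3
    linear_combination e3 - (x + r + x * (∫ t in (-r)..x, w t) - ∫ t in (-r)..x, t * w t) * e2
  have hwv : ∀ x, w x = U x * v x := by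
    intro x
    by_cases hx : r ≤ |x|
    · simp [hw, hUr x hx]
    · rw [hvψ x (abs_le.1 (not_le.1 hx).le)]
  have hwz : ∀ x, r ≤ |x| → w x = 0 := fun x hx => by simp [hw, hUr x hx]
  have hpl : ∀ x ≤ -r, p x = 1 := by
    intro x hx
    rw [hp.eq_of_eqOn_zero (a := x) (b := -r)]
    · simp [hpdef]
    · intro y hy
      rw [Set.uIcc_of_le hx] at hy
      exact hwz y (by rw [abs_of_nonpos (by linarith [hy.2])]; linarith [hy.2])
  have hpr : ∀ x, r ≤ x → p x = p r := by
    intro x hx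
    refine (hp.eq_of_eqOn_zero (a := r) (b := x) fun y hy => ?_).symm
    rw [Set.uIcc_of_le hx] at hy
    exact hwz y (hy.1.trans (le_abs_self _))
  obtain ⟨C, hC⟩ := isCompact_Icc.exists_bound_of_continuousOn
    (s := Set.Icc (-r) r) hp.continuous.continuousOn
  have hC' : ∀ x, ‖p x‖ ≤ C := by
    intro x
    rcases le_total x (-r) with h | h
    · rw [hpl x h, ← hpl (-r) le_rfl]
      exact hC _ ⟨le_rfl, hab⟩
    · rcases le_total x r with h' | h'
      · exact hC x ⟨h, h'⟩
      · rw [hpr x h']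
        exact hC _ ⟨hab, le_rfl⟩
  refine ⟨v, p, C, hv, hp.congr hwv, fun x hx => ?_, hpl, (norm_nonneg _).trans (hC' 0),
    fun x => ?_⟩
  · have : ∫ t in (-r)..x, p t = ∫ t in (-r)..x, (1 : ℝ) := by
      refine intervalIntegral.integral_congr fun t ht => ?_
      rw [Set.uIcc_of_ge hx] at ht
      exact hpl t ht.2
    simp only [hvdef, this, zero_add, intervalIntegral.integral_const, smul_eq_mul]
    ring
  · have := intervalIntegral.norm_integral_le_of_norm_le_const (f := p) (a := -r) (b := x)
      fun t _ => hC' t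
    simpa [hvdef] using this

theorem eq_zero_of_tendsto_of_shift {u : ℝ → ℝ} {l : Filter ℝ} [l.NeBot] {c L s : ℝ}
    (hu : Tendsto u l (𝓝 L)) (hs : Tendsto (fun x => x + s) l l)
    (h : ∀ᶠ x in l, u (x + s) - u x = c) : c = 0 := by
  have h1 : Tendsto (fun x => u (x + s) - u x) l (𝓝 (L - L)) := (hu.comp hs).sub hu
  rw [sub_self] at h1
  exact tendsto_nhds_unique (tendsto_const_nhds.congr' (h.mono fun x hx => hx.symm)) h1

theorem IsZeroEnergySolution.isPrimitive {U u : ℝ → ℝ} (h : IsZeroEnergySolution U u)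
    (hU : LocallyIntegrable U) :
    IsPrimitive u (deriv u) ∧ IsPrimitive (deriv u) (fun x => U x * u x) := by
  obtain ⟨hd, hac, heq⟩ := h
  have hc : Continuous (deriv u) := by
    refine continuous_iff_continuousAt.2 fun x => ?_
    refine (hac (x - 1) (x + 1)).continuousOn.continuousAt ?_
    rw [Set.uIcc_of_le (by linarith)]
    exact Icc_mem_nhds (by linarith) (by linarith)
  refine ⟨isPrimitive_of_hasDerivAt (fun x => (hd x).hasDerivAt) hc,
    locallyIntegrable_mul_continuous hU hd.continuous, fun a b => ?_⟩
  rw [← (hac a b).integral_deriv_eq_sub]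
  refine intervalIntegral.integral_congr_ae ?_
  filter_upwards [heq] with x hx _
  linarith

/-- Outside the support of the potential a zero-energy solution is affine, so it is constant there
as soon as it has a limit. -/
theorem eq_limit_of_outside_support {U u u' : ℝ → ℝ} (hu : IsPrimitive u u')
    (hu' : IsPrimitive u' (fun x => U x * u x)) {r : ℝ} (hr : 0 < r)
    (hUr : ∀ x, r ≤ |x| → U x = 0) {θ₀ θ : ℝ} (hb : Tendsto u atBot (𝓝 θ₀))
    (ht : Tendsto u atTop (𝓝 θ)) :
    (∀ x ≤ -r, u x = θ₀ ∧ u' x = 0) ∧ ∀ x, r ≤ x → u x = θ ∧ u' x = 0 := by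
  have step : ∀ {l : Filter ℝ} [l.NeBot] {L s c : ℝ} {S : Set ℝ}, S ∈ l →
      (∀ x ∈ S, ∀ y ∈ S, Set.uIcc x y ⊆ S) → (∀ x ∈ S, r ≤ |x|) → s ≠ 0 → c ∈ S →
      Tendsto (fun x => x + s) l l → Tendsto u l (𝓝 L) → ∀ x ∈ S, u x = L ∧ u' x = 0 := by
    intro l _ L s c S hS hconv hSr hs hc hshift hL
    have h1 : ∀ x ∈ S, u' x = u' c := fun x hx =>
      hu'.eq_of_eqOn_zero fun y hy => by rw [hUr y (hSr y (hconv x hx c hc hy)), zero_mul]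
    have h2 : ∀ x ∈ S, ∀ y ∈ S, u y - u x = (y - x) * u' c := fun x hx y hy => by
      rw [← hu.integral_eq, intervalIntegral.integral_congr (g := fun _ => u' c)
        fun t ht => h1 t (hconv x hx y hy ht), intervalIntegral.integral_const, smul_eq_mul]
    have h3 : s * u' c = 0 := eq_zero_of_tendsto_of_shift hL hshift (by
      filter_upwards [hS, hshift hS] with x hx hx'
      rw [h2 x hx _ hx', add_sub_cancel_left])
    have h4 : u' c = 0 := (mul_eq_zero.1 h3).resolve_left hs
    refine fun x hx => ⟨?_, (h1 x hx).trans h4⟩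
    refine tendsto_nhds_unique (tendsto_const_nhds.congr' ?_) hL
    filter_upwards [hS] with y hy
    have := h2 x hx y hy
    rw [h4, mul_zero] at this
    linarith
  constructor
  · refine step (s := -1) (c := -r) (Iic_mem_atBot (-r)) ?_ ?_ (by norm_num) Set.self_mem_Iic ?_ hb
    · exact fun x hx y hy => Set.OrdConnected.uIcc_subset Set.ordConnected_Iic hx hy
    · intro x hx
      have hx : x ≤ -r := hx
      rw [abs_of_nonpos (by linarith)]
      linarith
    · exact tendsto_atBot_add_const_right _ _ tendsto_id
  · refine step (s := 1) (c := r) (Ici_mem_atTop r) ?_ ?_ (by norm_num) Set.self_mem_Ici ?_ ht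
    · exact fun x hx y hy => Set.OrdConnected.uIcc_subset Set.ordConnected_Ici hx hy
    · exact fun x hx => (Set.mem_Ici.1 hx).trans (le_abs_self x)
    · exact tendsto_atTop_add_const_right _ _ tendsto_id

/-- The Wronskian of two solutions of the same equation is constant. -/
theorem wronskian_eq {U u u' v v' : ℝ → ℝ} (hu : IsPrimitive u u')
    (hu' : IsPrimitive u' (fun x => U x * u x)) (hv : IsPrimitive v v')
    (hv' : IsPrimitive v' (fun x => U x * v x)) (x y : ℝ) :
    u x * v' x - u' x * v x = u y * v' y - u' y * v y := by
  have h := (hu.mul hv').add (hu'.mul hv).neg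
  have := h.eq_of_eqOn_zero (a := x) (b := y) fun t _ => by ring
  linarith

/-! ### The shooting function -/

/-- A normalized half-bound state `u` of `-d²/dx² + U` with limit `θ` at `+∞`, together with a
second zero-energy solution `v` that completes it to a fundamental system of Wronskian one. Here
`u'`, `v'` are the derivatives, the support of `U` lies in `[-r, r]`, and `C` controls `u` and the
linear growth of `v`. -/
structure IsResonantSystem (U u u' v v' : ℝ → ℝ) (r θ C : ℝ) : Prop where
  r_pos : 0 < r
  C_nonneg : 0 ≤ C
  prim_u : IsPrimitive u u'
  prim_u' : IsPrimitive u' (fun x => U x * u x)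
  prim_v : IsPrimitive v v'
  prim_v' : IsPrimitive v' (fun x => U x * v x)
  wronskian : ∀ x, u x * v' x - u' x * v x = 1
  left_u : ∀ x ≤ -r, u x = 1
  left_u' : ∀ x ≤ -r, u' x = 0
  left_v : ∀ x ≤ -r, v x = x + r
  left_v' : ∀ x ≤ -r, v' x = 1
  right_u : ∀ x, r ≤ x → u x = θ
  right_u' : ∀ x, r ≤ x → u' x = 0
  abs_u_le : ∀ x, |u x| ≤ C
  abs_v_le : ∀ x, |v x| ≤ C * |x + r|
  U_eq_zero : ∀ x, r ≤ |x| → U x = 0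

theorem IsNormalizedHalfBoundState.exists_resonantSystem {U u : ℝ → ℝ} {θ : ℝ}
    (hu : IsNormalizedHalfBoundState U u) (hθ : Tendsto u atTop (𝓝 θ))
    (hU : LocallyIntegrable U) {r : ℝ} (hr : 0 < r) (hUr : ∀ x, r ≤ |x| → U x = 0) :
    ∃ u' v v' C, IsResonantSystem U u u' v v' r θ C := by
  obtain ⟨⟨hsol, -, C₁, hC₁⟩, hb⟩ := hu
  obtain ⟨p1, p2⟩ := hsol.isPrimitive hU
  obtain ⟨hl, hrt⟩ := eq_limit_of_outside_support p1 p2 hr hUr hb hθ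
  obtain ⟨v, v', C₂, q1, q2, hv, hv', hC₂, hvC⟩ := exists_growing_solution hU hr hUr
  refine ⟨deriv u, v, v', max C₁ C₂, hr, hC₂.trans (le_max_right _ _), p1, p2, q1, q2, ?_,
    fun x hx => (hl x hx).1, fun x hx => (hl x hx).2, hv, hv', fun x hx => (hrt x hx).1,
    fun x hx => (hrt x hx).2, fun x => (hC₁ x).trans (le_max_left _ _), fun x => ?_, hUr⟩
  · intro x
    rw [wronskian_eq p1 p2 q1 q2 x (-r), (hl _ le_rfl).1, (hl _ le_rfl).2, hv' _ le_rfl]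
    ring
  · exact (hvC x).trans (mul_le_mul_of_nonneg_right (le_max_right _ _) (abs_nonneg _))

/-- The solution of `-ψ'' + (U + q)ψ = -κ²ψ` on `[-R, R]` with `ψ(-R) = 1` and `ψ'(-R) = κ`, in the
form given by variation of constants. -/
def IsShootingSolution (u v q : ℝ → ℝ) (r R κ : ℝ) (ψ : ℝ → ℝ) : Prop :=
  Continuous ψ ∧ ∀ x ∈ Set.Icc (-R) R, ψ x = u x + κ * (v x + (R - r) * u x) +
    (v x * (∫ t in (-R)..x, (q t + κ ^ 2) * u t * ψ t) -
      u x * ∫ t in (-R)..x, (q t + κ ^ 2) * v t * ψ t)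

/-- The shooting function. If `ψ` is the shooting solution, this is `θ (ψ'(R) + κ ψ(R))`, so its
zeros are the values of `κ` for which `-κ²` is an eigenvalue. -/
noncomputable def shootingValue (u q : ℝ → ℝ) (θ R κ : ℝ) (ψ : ℝ → ℝ) : ℝ :=
  κ + (∫ t in (-R)..R, (q t + κ ^ 2) * u t * ψ t) + κ * θ * ψ R

namespace IsResonantSystem

variable {U u u' v v' q Q : ℝ → ℝ} {r θ C R : ℝ}

theorem abs_v_le_of_mem (D : IsResonantSystem U u u' v v' r θ C) (hR : r ≤ R) {x : ℝ}
    (hx : x ∈ Set.Icc (-R) R) : |v x| ≤ 2 * C * R := by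
  refine (D.abs_v_le x).trans ?_
  have h1 := D.r_pos
  have h2 : |x + r| ≤ 2 * R := abs_le.2 ⟨by linarith [hx.1], by linarith [hx.2]⟩
  calc C * |x + r| ≤ C * (2 * R) := mul_le_mul_of_nonneg_left h2 D.C_nonneg
    _ = 2 * C * R := by ring

theorem abs_kernel_le (D : IsResonantSystem U u u' v v' r θ C) (hR : r ≤ R) {x t : ℝ}
    (hx : x ∈ Set.Icc (-R) R) (ht : t ∈ Set.Icc (-R) R) :
    |v x * u t + -u x * v t| ≤ 4 * C ^ 2 * R := by
  have hC := D.C_nonneg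
  have hR0 : 0 ≤ R := D.r_pos.le.trans hR
  calc |v x * u t + -u x * v t| ≤ |v x * u t| + |-u x * v t| := abs_add_le _ _
    _ = |v x| * |u t| + |u x| * |v t| := by rw [abs_mul, abs_mul, abs_neg]
    _ ≤ (2 * C * R) * C + C * (2 * C * R) := by
        have a1 := D.abs_v_le_of_mem hR hx
        have a2 := D.abs_v_le_of_mem hR ht
        have a3 := D.abs_u_le x
        have a4 := D.abs_u_le t
        gcongr
    _ = 4 * C ^ 2 * R := by ring

/-- Shooting solutions exist as long as the Volterra operator has norm at most `1/2`; they are then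
close to `u`, and the shooting function is continuous in `κ`. -/
theorem exists_shooting_family (D : IsResonantSystem U u u' v v' r θ C) (hR : r ≤ R)
    (hq : LocallyIntegrable q) :
    ∃ ψ : ℝ → ℝ → ℝ,
      ContinuousOn (fun κ => shootingValue u q θ R κ (ψ κ))
        {κ | 4 * C ^ 2 * R * ∫ t in (-R)..R, |q t + κ ^ 2| ≤ 1 / 2} ∧
      ∀ κ, 0 ≤ κ → 4 * C ^ 2 * R * ∫ t in (-R)..R, |q t + κ ^ 2| ≤ 1 / 2 →
        IsShootingSolution u v q r R κ (ψ κ) ∧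
        ∀ x ∈ Set.Icc (-R) R, |ψ κ x - u x| ≤ 3 * C * R * κ +
          (4 * C ^ 2 * R * ∫ t in (-R)..R, |q t + κ ^ 2|) * (2 * (C + κ * (3 * C * R))) := by
  have hr := D.r_pos
  have hC := D.C_nonneg
  have hR0 : 0 < R := hr.trans_le hR
  have hab : -R ≤ R := by linarith
  have cu := D.prim_u.continuous
  have cv := D.prim_v.continuous
  obtain ⟨Ψ, hΨc, hΨ⟩ := exists_volterra_family hab (g₁ := v) (h₁ := u)
    (g₂ := fun x => -u x) (h₂ := v) (f₀ := u) (f₁ := fun x => v x + (R - r) * u x)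
    cv cu cu.neg cv hq cu (by fun_prop) (M := 4 * C ^ 2 * R)
    (fun x t ht htx hx => D.abs_kernel_le hR ⟨ht.trans htx, hx⟩ ⟨ht, htx.trans hx⟩)
  refine ⟨fun κ => Set.IccExtend hab (Ψ κ), ?_, fun κ hκ0 hκ => ?_⟩
  · dsimp only
    have e : ∀ κ, shootingValue u q θ R κ (Set.IccExtend hab (Ψ κ)) =
        κ + (volterraPrimitive hab _ (locallyIntegrable_mul_continuous hq cu) (Ψ κ) ⟨R, hab, le_rfl⟩
          + κ ^ 2 * volterraPrimitive hab _ cu.locallyIntegrable (Ψ κ) ⟨R, hab, le_rfl⟩) +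
          κ * θ * Ψ κ ⟨R, hab, le_rfl⟩ := by
      intro κ
      have hc := continuous_iccExtend hab (Ψ κ)
      have i1 := intervalIntegrable_of_locallyIntegrable (locallyIntegrable_mul_continuous
        (locallyIntegrable_mul_continuous hq cu) hc) (-R) R
      have i2 : IntervalIntegrable (fun t => κ ^ 2 * (u t * Set.IccExtend hab (Ψ κ) t))
          volume (-R) R := (continuous_const.mul (cu.mul hc)).intervalIntegrable _ _
      rw [volterraPrimitive_apply, volterraPrimitive_apply,
        ← intervalIntegral.integral_const_mul (κ ^ 2), ← intervalIntegral.integral_add i1 i2,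
        shootingValue,
        Set.IccExtend_of_mem hab (Ψ κ) (⟨hab, le_rfl⟩ : R ∈ Set.Icc (-R) R)]
      have e : ∫ t in (-R)..R, (q t + κ ^ 2) * u t * Set.IccExtend hab (Ψ κ) t =
          ∫ t in (-R)..R, (q t * u t * Set.IccExtend hab (Ψ κ) t +
            κ ^ 2 * (u t * Set.IccExtend hab (Ψ κ) t)) :=
        intervalIntegral.integral_congr fun t _ => by ring
      rw [e]
    simp only [e]
    have ev : ∀ (L : C(Set.Icc (-R) R, ℝ) →L[ℝ] C(Set.Icc (-R) R, ℝ)) (y : Set.Icc (-R) R),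
        ContinuousOn (fun κ => L (Ψ κ) y)
          {κ | 4 * C ^ 2 * R * ∫ t in (-R)..R, |q t + κ ^ 2| ≤ 1 / 2} := fun L y =>
      ((continuous_eval_const y).comp L.continuous).comp_continuousOn hΨc
    have ev' := ev (ContinuousLinearMap.id ℝ _) ⟨R, hab, le_rfl⟩
    exact (continuousOn_id.add ((ev _ _).add ((continuousOn_id.pow 2).mul (ev _ _)))).add
      ((continuousOn_id.mul continuousOn_const).mul ev')
  · dsimp only
    obtain ⟨h1, h2⟩ := hΨ κ hκ
    have hf : ∀ x ∈ Set.Icc (-R) R, |κ * (v x + (R - r) * u x)| ≤ κ * (3 * C * R) := by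
      intro x hx
      rw [abs_mul, abs_of_nonneg hκ0]
      refine mul_le_mul_of_nonneg_left ?_ hκ0
      calc |v x + (R - r) * u x| ≤ |v x| + |(R - r) * u x| := abs_add_le _ _
        _ = |v x| + (R - r) * |u x| := by rw [abs_mul, abs_of_nonneg (sub_nonneg.2 hR)]
        _ ≤ 2 * C * R + R * C := by
            have a1 := D.abs_v_le_of_mem hR hx
            have a2 := D.abs_u_le x
            have a3 : R - r ≤ R := by linarith
            gcongr
        _ = 3 * C * R := by ring
    refine ⟨⟨continuous_iccExtend hab _, fun x hx => ?_⟩, fun x hx => ?_⟩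
    · rw [Set.IccExtend_of_mem hab (Ψ κ) hx, h1 ⟨x, hx⟩]
      ring
    · rw [Set.IccExtend_of_mem hab (Ψ κ) hx]
      have b1 := h2 (C + κ * (3 * C * R)) (fun y hy =>
        (abs_add_le _ _).trans (add_le_add (D.abs_u_le y) (hf y hy))) ⟨x, hx⟩
      have b2 := hf x hx
      have e : Ψ κ ⟨x, hx⟩ - u x = (Ψ κ ⟨x, hx⟩ - (u x + κ * (v x + (R - r) * u x))) +
          κ * (v x + (R - r) * u x) := by ring
      rw [e]
      refine (abs_add_le _ _).trans ?_
      dsimp only at b1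
      linarith

/-- First-order expansion of the shooting function. -/
theorem abs_shootingValue_sub_le (D : IsResonantSystem U u u' v v' r θ C) (hR : r ≤ R)
    (hq : LocallyIntegrable q) {κ ε : ℝ} {ψ : ℝ → ℝ} (hκ : 0 ≤ κ) (hψc : Continuous ψ)
    (hψ : ∀ x ∈ Set.Icc (-R) R, |ψ x - u x| ≤ ε) :
    |shootingValue u q θ R κ ψ - (κ * (1 + θ ^ 2) + ∫ t in (-R)..R, q t * u t ^ 2)| ≤
      (C * ε) * (∫ t in (-R)..R, |q t|) + κ ^ 2 * (C * (C + ε) * (2 * R)) + κ * |θ| * ε := by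
  have hC := D.C_nonneg
  have hR0 : 0 < R := D.r_pos.trans_le hR
  have hab : -R ≤ R := by linarith
  have cu := D.prim_u.continuous
  have i1 := intervalIntegrable_of_locallyIntegrable (locallyIntegrable_mul_continuous hq
    (g := fun t => u t * (ψ t - u t)) (by fun_prop)) (-R) R
  have i2 : IntervalIntegrable (fun t => κ ^ 2 * (u t * ψ t)) volume (-R) R :=
    (continuous_const.mul (cu.mul hψc)).intervalIntegrable _ _
  have i3 := intervalIntegrable_of_locallyIntegrable (locallyIntegrable_mul_continuous hq
    (g := fun t => u t ^ 2) (by fun_prop)) (-R) R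
  have e1 : ∫ t in (-R)..R, (q t + κ ^ 2) * u t * ψ t =
      (∫ t in (-R)..R, q t * (u t * (ψ t - u t))) + (∫ t in (-R)..R, κ ^ 2 * (u t * ψ t)) +
        ∫ t in (-R)..R, q t * u t ^ 2 := by
    rw [← intervalIntegral.integral_add i1 i2, ← intervalIntegral.integral_add (i1.add i2) i3]
    refine intervalIntegral.integral_congr fun t _ => ?_
    ring
  have e2 : shootingValue u q θ R κ ψ - (κ * (1 + θ ^ 2) + ∫ t in (-R)..R, q t * u t ^ 2) =
      (∫ t in (-R)..R, q t * (u t * (ψ t - u t))) + (∫ t in (-R)..R, κ ^ 2 * (u t * ψ t)) +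
        κ * θ * (ψ R - u R) := by
    rw [shootingValue, e1, D.right_u R hR]
    ring
  have b1 : |∫ t in (-R)..R, q t * (u t * (ψ t - u t))| ≤ (C * ε) * ∫ t in (-R)..R, |q t| := by
    rw [← intervalIntegral.integral_const_mul, ← Real.norm_eq_abs]
    refine intervalIntegral.norm_integral_le_of_norm_le hab (Eventually.of_forall fun t ht => ?_)
      ((intervalIntegrable_of_locallyIntegrable hq _ _).abs.const_mul _)
    rw [norm_mul, norm_mul, mul_comm, Real.norm_eq_abs, Real.norm_eq_abs, Real.norm_eq_abs]
    have a1 := D.abs_u_le t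
    have a2 := hψ t ⟨ht.1.le, ht.2⟩
    gcongr
  have b2 : |∫ t in (-R)..R, κ ^ 2 * (u t * ψ t)| ≤ κ ^ 2 * (C * (C + ε) * (2 * R)) := by
    have := intervalIntegral.norm_integral_le_of_norm_le_const (a := -R) (b := R)
      (f := fun t => κ ^ 2 * (u t * ψ t)) (C := κ ^ 2 * (C * (C + ε))) fun t ht => by
        rw [Set.uIoc_of_le hab] at ht
        have a1 := D.abs_u_le t
        have a2 := hψ t ⟨ht.1.le, ht.2⟩
        have a3 : |ψ t| ≤ C + ε := by
          have := abs_add_le (u t) (ψ t - u t)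
          rw [add_sub_cancel] at this
          linarith
        rw [norm_mul, norm_mul, Real.norm_eq_abs, Real.norm_eq_abs, Real.norm_eq_abs,
          abs_of_nonneg (sq_nonneg κ)]
        gcongr
    rw [Real.norm_eq_abs] at this
    have e : |R - -R| = 2 * R := by
      rw [abs_of_nonneg (by linarith)]
      ring
    rw [e] at this
    linarith
  have b3 : |κ * θ * (ψ R - u R)| ≤ κ * |θ| * ε := by
    rw [abs_mul, abs_mul, abs_of_nonneg hκ]
    have := hψ R ⟨hab, le_rfl⟩
    gcongr
  rw [e2]
  refine (abs_add_le _ _).trans (add_le_add ((abs_add_le _ _).trans (add_le_add b1 b2)) b3)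

end IsResonantSystem

/-! ### Eigenfunctions from zeros of the shooting function -/

theorem IsPrimitive.glue {F f G g : ℝ → ℝ} {c : ℝ} (hF : IsPrimitive F f) (hG : IsPrimitive G g)
    (hc : F c = G c) :
    IsPrimitive (fun x => if x ≤ c then F x else G x) (fun x => if x ≤ c then f x else g x) := by
  have hl : LocallyIntegrable (fun x => if x ≤ c then f x else g x) := by
    have := (hF.locallyIntegrable.indicator (measurableSet_Iic (a := c))).add
      (hG.locallyIntegrable.indicator (measurableSet_Ioi (a := c)))
    have e : (fun x => if x ≤ c then f x else g x) =
        (Set.Iic c).indicator f + (Set.Ioi c).indicator g := by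
      funext x
      by_cases hx : x ≤ c
      · simp [hx]
      · simp [hx, lt_of_not_ge hx]
    rwa [e]
  have key : ∀ x, ∫ t in c..x, (if t ≤ c then f t else g t) =
      (if x ≤ c then F x else G x) - F c := by
    intro x
    by_cases hx : x ≤ c
    · rw [if_pos hx, ← hF.integral_eq]
      refine intervalIntegral.integral_congr fun t ht => ?_
      rw [Set.uIcc_of_ge hx] at ht
      simp only [if_pos ht.2]
    · rw [if_neg hx, hc, ← hG.integral_eq]
      refine intervalIntegral.integral_congr_ae (Eventually.of_forall fun t ht => ?_)
      rw [Set.uIoc_of_le (le_of_not_ge hx)] at ht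
      simp only [if_neg (not_le.2 ht.1)]
  refine ⟨hl, fun a b => ?_⟩
  have h1 := intervalIntegral.integral_add_adjacent_intervals
    (intervalIntegrable_of_locallyIntegrable hl c a)
    (intervalIntegrable_of_locallyIntegrable hl a b)
  rw [key, key] at h1
  linarith

theorem isPrimitive_exp (A μ c : ℝ) :
    IsPrimitive (fun x => A * Real.exp (μ * (x - c))) (fun x => μ * A * Real.exp (μ * (x - c))) := by
  refine isPrimitive_of_hasDerivAt (fun x => ?_) (by fun_prop)
  have h : HasDerivAt (fun x : ℝ => μ * (x - c)) μ x := by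
    simpa using ((hasDerivAt_id x).sub_const c).const_mul μ
  have := (h.exp).const_mul A
  rwa [show A * (Real.exp (μ * (x - c)) * μ) = μ * A * Real.exp (μ * (x - c)) by ring] at this

theorem memLp_exp_neg_mul_abs {κ : ℝ} (hκ : 0 < κ) :
    MemLp (fun x : ℝ => Real.exp (-(κ * |x|))) 2 volume := by
  have hc : Continuous fun x : ℝ => Real.exp (-(κ * |x|)) := by fun_prop
  rw [memLp_two_iff_integrable_sq hc.aestronglyMeasurable, ← integrableOn_univ,
    ← Set.Iic_union_Ioi (a := (0 : ℝ))]
  refine IntegrableOn.union ?_ ?_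
  · refine (integrableOn_exp_mul_Iic (a := 2 * κ) (by linarith) 0).congr_fun (fun x hx => ?_)
      measurableSet_Iic
    simp only
    rw [abs_of_nonpos hx, ← Real.exp_nat_mul]
    congr 1
    push_cast
    ring
  · refine (integrableOn_exp_mul_Ioi (a := -(2 * κ)) (by linarith) 0).congr_fun (fun x hx => ?_)
      measurableSet_Ioi
    simp only
    rw [abs_of_pos hx, ← Real.exp_nat_mul]
    congr 1
    push_cast
    ring

/-- A continuous function with exponential tails is square integrable. -/
theorem memLp_of_exponential_tails {f : ℝ → ℝ} {κ R A B : ℝ} (hκ : 0 < κ) (hR : 0 < R)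
    (hf : Continuous f) (hl : ∀ x ≤ -R, f x = A * Real.exp (κ * (x - -R)))
    (hr : ∀ x, R ≤ x → f x = B * Real.exp (-κ * (x - R))) :
    MemLp (fun x => (f x : ℂ)) 2 volume := by
  have hab : -R ≤ R := by linarith
  have hg : Continuous fun x => f x * Real.exp (κ * |x|) := by fun_prop
  obtain ⟨K, hK⟩ := isCompact_Icc.exists_bound_of_continuousOn
    (s := Set.Icc (-R) R) hg.continuousOn
  have hA : ∀ x ≤ -R, f x * Real.exp (κ * |x|) = A * Real.exp (κ * R) := fun x hx => by
    rw [hl x hx, abs_of_nonpos (by linarith), mul_assoc, ← Real.exp_add]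
    congr 2
    ring
  have hB : ∀ x, R ≤ x → f x * Real.exp (κ * |x|) = B * Real.exp (κ * R) := fun x hx => by
    rw [hr x hx, abs_of_nonneg (by linarith), mul_assoc, ← Real.exp_add]
    congr 2
    ring
  have hb : ∀ x, ‖f x * Real.exp (κ * |x|)‖ ≤ K := by
    intro x
    rcases le_total x (-R) with h | h
    · rw [hA x h, ← hA (-R) le_rfl]
      exact hK _ ⟨le_rfl, hab⟩
    · rcases le_total x R with h' | h'
      · exact hK x ⟨h, h'⟩
      · rw [hB x h', ← hB R le_rfl]
        exact hK _ ⟨hab, le_rfl⟩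
  refine MemLp.of_le_mul (c := K) (memLp_exp_neg_mul_abs hκ)
    (Complex.continuous_ofReal.comp hf).aestronglyMeasurable (Eventually.of_forall fun x => ?_)
  have e : f x = f x * Real.exp (κ * |x|) * Real.exp (-(κ * |x|)) := by
    rw [mul_assoc, ← Real.exp_add]
    simp
  rw [Complex.norm_real, e, norm_mul]
  exact mul_le_mul_of_nonneg_right (hb x) (norm_nonneg _)

/-- A square integrable solution of `-φ'' + W φ = E φ` is an eigenfunction. -/
theorem isEigenvalue_of_solution {W φ φ' : ℝ → ℝ} {E : ℝ} (hW : MemLp W ⊤ volume)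
    (h₁ : IsPrimitive φ φ') (h₂ : IsPrimitive φ' (fun x => (W x - E) * φ x))
    (hφ : MemLp (fun x => (φ x : ℂ)) 2 volume) (hφ' : MemLp (fun x => (φ' x : ℂ)) 2 volume)
    {x₀ : ℝ} (hne : φ x₀ ≠ 0) : IsEigenvalue (schrodinger W) (E : ℂ) := by
  have hWφ : MemLp (fun x => (W x : ℂ) * φ x) 2 volume := MemLp.mul' hφ hW.ofReal
  have hφ'' : MemLp (fun x => (((W x - E) * φ x : ℝ) : ℂ)) 2 volume := by
    have := hWφ.sub (hφ.const_mul (E : ℂ))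
    refine (memLp_congr_ae (Eventually.of_forall fun x => ?_)).2 this
    simp
    ring
  have hsec : HasSecondDeriv hφ.toLp hφ''.toLp := ⟨hφ'.toLp,
    h₁.hasWeakDeriv.congr hφ.coeFn_toLp.symm hφ'.coeFn_toLp.symm,
    h₂.hasWeakDeriv.congr hφ'.coeFn_toLp.symm hφ''.coeFn_toLp.symm⟩
  have hdom : hφ.toLp ∈ (schrodinger W).domain := by
    rw [schrodinger_domain hW]
    exact ⟨_, hsec⟩
  refine ⟨⟨hφ.toLp, hdom⟩, fun h0 => ?_, ?_⟩
  · have h1 : (fun x => (φ x : ℂ)) =ᵐ[volume] fun _ => 0 := by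
      have h0' : hφ.toLp = 0 := h0
      have := hφ.coeFn_toLp
      rw [h0'] at this
      exact this.symm.trans (Lp.coeFn_zero _ _ _)
    have h2 := (Continuous.ae_eq_iff_eq volume (Complex.continuous_ofReal.comp h₁.continuous)
      continuous_const).1 h1
    exact hne (by simpa using congrFun h2 x₀)
  · have e1 : secondDeriv ⟨hφ.toLp, hdom.1⟩ = hφ''.toLp :=
      (Exists.choose_spec (⟨hφ.toLp, hdom.1⟩ : W22).2).unique hsec
    have e2 : schrodinger W ⟨hφ.toLp, hdom⟩ =
        -secondDeriv ⟨hφ.toLp, hdom.1⟩ + mulPotential W ⟨hφ.toLp, hdom.2⟩ := rfl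
    rw [e2, e1]
    refine Lp.ext ?_
    filter_upwards [Lp.coeFn_add (-hφ''.toLp) (mulPotential W ⟨hφ.toLp, hdom.2⟩),
      Lp.coeFn_neg hφ''.toLp, hφ''.coeFn_toLp, MemLp.coeFn_toLp hdom.2, hφ.coeFn_toLp,
      Lp.coeFn_smul (E : ℂ) hφ.toLp] with x a1 a2 a3 a4 a5 a6
    have a4' : (mulPotential W ⟨hφ.toLp, hdom.2⟩) x =
        (W x : ℂ) * (hφ.toLp (fun x => (φ x : ℂ))) x := a4
    rw [a1, Pi.add_apply, a2, Pi.neg_apply, a3, a4', a6, Pi.smul_apply, a5, smul_eq_mul]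
    push_cast
    ring

/-- A solution on `[-R, R]` whose logarithmic derivatives at the endpoints are those of the
decaying exponentials extends to an eigenfunction if the potential vanishes outside. -/
theorem isEigenvalue_of_matching {W Ψ P G : ℝ → ℝ} {R κ : ℝ} (hW : MemLp W ⊤ volume)
    (hR : 0 < R) (hκ : 0 < κ) (hWR : ∀ x, R ≤ |x| → W x = 0) (h₁ : IsPrimitive Ψ P)
    (h₂ : IsPrimitive P G) (hG : ∀ x ∈ Set.Icc (-R) R, G x = (W x + κ ^ 2) * Ψ x)
    (hl : P (-R) = κ * Ψ (-R)) (hr : P R = -κ * Ψ R) (hne : Ψ (-R) ≠ 0) :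
    IsEigenvalue (schrodinger W) ((-κ ^ 2 : ℝ) : ℂ) := by
  have hab : -R ≤ R := by linarith
  set A := Ψ (-R) with hA
  set B := Ψ R with hB
  have eR := isPrimitive_exp B (-κ) R
  have eR' := isPrimitive_exp (-κ * B) (-κ) R
  have eL := isPrimitive_exp A κ (-R)
  have eL' := isPrimitive_exp (κ * A) κ (-R)
  have g1 := eL.glue (h₁.glue eR (c := R) (by simp [hB])) (c := -R) (by simp [hab, hA])
  have g2 := eL'.glue (h₂.glue eR' (c := R) (by simp [hr])) (c := -R) (by simp [hab, hl])
  set φ : ℝ → ℝ := fun x => if x ≤ -R then A * Real.exp (κ * (x - -R)) else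
    if x ≤ R then Ψ x else B * Real.exp (-κ * (x - R)) with hφ
  set φ' : ℝ → ℝ := fun x => if x ≤ -R then κ * A * Real.exp (κ * (x - -R)) else
    if x ≤ R then P x else -κ * B * Real.exp (-κ * (x - R)) with hφ'
  have hsec : ∀ x, (if x ≤ -R then κ * (κ * A) * Real.exp (κ * (x - -R)) else
      if x ≤ R then G x else -κ * (-κ * B) * Real.exp (-κ * (x - R))) =
      (W x - (-κ ^ 2)) * φ x := by
    intro x
    simp only [hφ]
    split_ifs with h h'
    · rw [hWR x (by rw [abs_of_nonpos (by linarith)]; linarith)]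
      ring
    · rw [hG x ⟨(not_le.1 h).le, h'⟩]
      ring
    · rw [hWR x ((not_le.1 h').le.trans (le_abs_self x))]
      ring
  have tr : ∀ {F : ℝ → ℝ} {a b : ℝ}, F R = b → ∀ x, R ≤ x →
      (if x ≤ -R then a * Real.exp (κ * (x - -R)) else
        if x ≤ R then F x else b * Real.exp (-κ * (x - R))) = b * Real.exp (-κ * (x - R)) := by
    intro F a b hF x hx
    rw [if_neg (by linarith)]
    split_ifs with h'
    · have : x = R := le_antisymm h' hx
      simp [this, hF]
    · rfl
  refine isEigenvalue_of_solution hW g1 (g2.congr hsec) (x₀ := -R) ?_ ?_ ?_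
  · exact memLp_of_exponential_tails hκ hR g1.continuous (fun x hx => if_pos hx) (tr rfl)
  · exact memLp_of_exponential_tails hκ hR g2.continuous (fun x hx => if_pos hx) (tr hr)
  · simpa [hφ] using hne

namespace IsResonantSystem

variable {U u u' v v' q : ℝ → ℝ} {r θ C R : ℝ}

/-- At a zero of the shooting function the shooting solution, continued to the line as `a u + b v`
with the coefficients `a`, `b` from variation of constants, matches decaying exponentials at `±R`. -/
theorem isEigenvalue_of_shootingValue_eq_zero (D : IsResonantSystem U u u' v v' r θ C)
    (hR : r ≤ R) (hq : LocallyIntegrable q) (hqR : ∀ x, R ≤ |x| → q x = 0)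
    (hW : MemLp (fun x => U x + q x) ⊤ volume) {κ : ℝ} (hκ : 0 < κ) {ψ : ℝ → ℝ}
    (hψ : IsShootingSolution u v q r R κ ψ) (h0 : shootingValue u q θ R κ ψ = 0) :
    IsEigenvalue (schrodinger fun x => U x + q x) ((-κ ^ 2 : ℝ) : ℂ) := by
  obtain ⟨hψc, hψ⟩ := hψ
  have hR0 : 0 < R := D.r_pos.trans_le hR
  have hab : -R ≤ R := by linarith
  have cu := D.prim_u.continuous
  have cv := D.prim_v.continuous
  have hqk : LocallyIntegrable fun t => q t + κ ^ 2 := hq.add continuous_const.locallyIntegrable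
  have ha := (isPrimitive_integral (locallyIntegrable_mul_continuous
    (locallyIntegrable_mul_continuous hqk cv) hψc) 0 (-R)).neg.add
      (isPrimitive_of_hasDerivAt (fun x => hasDerivAt_const x (1 + κ * (R - r))) continuous_const)
  have hb := isPrimitive_integral (locallyIntegrable_mul_continuous
    (locallyIntegrable_mul_continuous hqk cu) hψc) κ (-R)
  set a : ℝ → ℝ := fun x => -(0 + ∫ t in (-R)..x, (q t + κ ^ 2) * v t * ψ t) +
    (1 + κ * (R - r)) with ha_def
  set b : ℝ → ℝ := fun x => κ + ∫ t in (-R)..x, (q t + κ ^ 2) * u t * ψ t with hb_def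
  have p1 := ((ha.mul D.prim_u).add (hb.mul D.prim_v)).congr
    (g := fun x => a x * u' x + b x * v' x) fun x => by ring
  have p2 := ((ha.mul D.prim_u').add (hb.mul D.prim_v')).congr
    (g := fun x => U x * (a x * u x + b x * v x) + (q x + κ ^ 2) * ψ x) fun x => by
      linear_combination ((q x + κ ^ 2) * ψ x) * D.wronskian x
  have hΨ : ∀ x ∈ Set.Icc (-R) R, ψ x = a x * u x + b x * v x := fun x hx => by
    rw [hψ x hx]
    simp only [ha_def, hb_def]
    ring
  have haR : a (-R) = 1 + κ * (R - r) := by simp [ha_def]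
  have hbR : b (-R) = κ := by simp [hb_def]
  have hle : -R ≤ -r := by linarith
  -- At `R` one has `u' = 0` and `u v' = 1`, so `ψ'(R) = b(R) v'(R)` and `θ v'(R) = 1`.
  refine isEigenvalue_of_matching hW hR0 hκ (fun x hx => ?_) p1 p2 (fun x hx => ?_) ?_ ?_ ?_
  · rw [hqR x hx, D.U_eq_zero x (hR.trans hx), add_zero]
  · rw [← hΨ x hx]
    ring
  · rw [haR, hbR, D.left_u _ hle, D.left_u' _ hle, D.left_v _ hle, D.left_v' _ hle]
    ring
  · have h1 := D.wronskian R
    rw [D.right_u' R hR, D.right_u R hR] at h1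
    have h2 : b R + κ * θ * ψ R = 0 := h0
    rw [← hΨ R ⟨hab, le_rfl⟩, D.right_u' R hR]
    linear_combination v' R * h2 - κ * ψ R * h1
  · rw [haR, hbR, D.left_u _ hle, D.left_v _ hle]
    ring_nf
    norm_num

end IsResonantSystem

/-! ### Localization of an eigenvalue at fixed coupling -/

/-- A bound for `|ψ - u|` on `[-R, R]` in terms of `δ = λR`, where `ψ` is the shooting solution for
`κ = λs` and `N` bounds the `L¹` norm of the perturbation divided by `λ`. -/
noncomputable def solutionError (C N s δ : ℝ) : ℝ :=
  3 * C * (s * δ) + 4 * C ^ 2 * (δ * (N + 2 * s ^ 2 * δ)) * (2 * (C + 3 * C * (s * δ)))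

/-- A bound for the error in the first-order expansion of the shooting function, divided by `λ`. -/
noncomputable def shootingError (C N θ s δ : ℝ) : ℝ :=
  C * solutionError C N s δ * N + s ^ 2 * (C * (C + solutionError C N s δ) * (2 * δ)) +
    s * |θ| * solutionError C N s δ

theorem tendsto_shootingError (C N θ s : ℝ) : Tendsto (shootingError C N θ s) (𝓝 0) (𝓝 0) := by
  have h : Continuous (shootingError C N θ s) := by
    unfold shootingError solutionError
    fun_prop
  simpa [shootingError, solutionError] using h.tendsto 0

namespace IsResonantSystem

variable {U u u' v v' Q : ℝ → ℝ} {r θ C R N l : ℝ}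

/-- The bound, of order `λR`, for the norm of the Volterra operator at `κ = λs`. -/
theorem integral_abs_add_sq_le (D : IsResonantSystem U u u' v v' r θ C) (hR : r ≤ R)
    (hQ : LocallyIntegrable Q) (hN : ∫ t in (-R)..R, |Q t| ≤ N) (hl : 0 < l) (s : ℝ) :
    4 * C ^ 2 * R * ∫ t in (-R)..R, |l * Q t + (l * s) ^ 2| ≤
      4 * C ^ 2 * (l * R * (N + 2 * s ^ 2 * (l * R))) := by
  have hR0 : 0 < R := D.r_pos.trans_le hR
  have hab : -R ≤ R := by linarith
  have i0 := (intervalIntegrable_of_locallyIntegrable hQ (-R) R).abs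
  have i1 : IntervalIntegrable (fun t => l * |Q t| + (l * s) ^ 2) volume (-R) R :=
    (i0.const_mul l).add (continuous_const.intervalIntegrable _ _)
  have h1 : ∫ t in (-R)..R, |l * Q t + (l * s) ^ 2| ≤ l * N + 2 * R * (l * s) ^ 2 := by
    calc ∫ t in (-R)..R, |l * Q t + (l * s) ^ 2|
        ≤ ∫ t in (-R)..R, (l * |Q t| + (l * s) ^ 2) := by
          refine intervalIntegral.integral_mono_on hab ?_ i1 fun t _ => ?_
          · exact (((intervalIntegrable_of_locallyIntegrable hQ (-R) R).const_mul l).add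
              (continuous_const.intervalIntegrable _ _)).abs
          · refine (abs_add_le _ _).trans ?_
            rw [abs_mul, abs_of_pos hl, abs_of_nonneg (sq_nonneg (l * s))]
      _ = l * (∫ t in (-R)..R, |Q t|) + 2 * R * (l * s) ^ 2 := by
          rw [intervalIntegral.integral_add (i0.const_mul l)
            (continuous_const.intervalIntegrable _ _), intervalIntegral.integral_const_mul,
            intervalIntegral.integral_const, smul_eq_mul]
          ring
      _ ≤ l * N + 2 * R * (l * s) ^ 2 := by gcongr
  calc 4 * C ^ 2 * R * ∫ t in (-R)..R, |l * Q t + (l * s) ^ 2|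
      ≤ 4 * C ^ 2 * R * (l * N + 2 * R * (l * s) ^ 2) := by gcongr
    _ = 4 * C ^ 2 * (l * R * (N + 2 * s ^ 2 * (l * R))) := by ring

/-- If the first-order expansion of the shooting function has opposite signs at `λs₁` and `λs₂`,
beyond the error bound, then there is an eigenvalue `-(λs)²` with `s` between `s₁` and `s₂`. -/
theorem exists_eigenvalue_between (D : IsResonantSystem U u u' v v' r θ C) (hR : r ≤ R)
    (hQ : LocallyIntegrable Q) (hQR : ∀ x, R ≤ |x| → Q x = 0)
    (hN : ∫ t in (-R)..R, |Q t| ≤ N) (hl : 0 < l)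
    (hW : MemLp (fun x => U x + l * Q x) ⊤ volume) {s₁ s₂ : ℝ} (hs₁ : 0 < s₁) (hs : s₁ ≤ s₂)
    (hsmall : 4 * C ^ 2 * (l * R * (N + 2 * s₂ ^ 2 * (l * R))) ≤ 1 / 2)
    (h₁ : s₁ * (1 + θ ^ 2) + (∫ t in (-R)..R, Q t * u t ^ 2) +
      shootingError C N θ s₁ (l * R) < 0)
    (h₂ : 0 < s₂ * (1 + θ ^ 2) + (∫ t in (-R)..R, Q t * u t ^ 2) -
      shootingError C N θ s₂ (l * R)) :
    ∃ s ∈ Set.Icc s₁ s₂, IsEigenvalue (schrodinger fun x => U x + l * Q x)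
      ((-(l * s) ^ 2 : ℝ) : ℂ) := by
  have hR0 : 0 < R := D.r_pos.trans_le hR
  have hab : -R ≤ R := by linarith
  have hC := D.C_nonneg
  have hN0 : 0 ≤ N := (intervalIntegral.integral_nonneg hab fun t _ => abs_nonneg _).trans hN
  have hq : LocallyIntegrable fun x => l * Q x := hQ.smul l
  obtain ⟨ψ, hcont, hψ⟩ := D.exists_shooting_family hR hq
  have hbound : ∀ s, 0 ≤ s → s ≤ s₂ →
      4 * C ^ 2 * R * ∫ t in (-R)..R, |l * Q t + (l * s) ^ 2| ≤ 1 / 2 := fun s h0 h => by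
    refine (D.integral_abs_add_sq_le hR hQ hN hl s).trans (le_trans ?_ hsmall)
    gcongr
  have hexp : ∀ s, 0 ≤ s → s ≤ s₂ →
      |shootingValue u (fun x => l * Q x) θ R (l * s) (ψ (l * s)) -
        l * (s * (1 + θ ^ 2) + ∫ t in (-R)..R, Q t * u t ^ 2)| ≤
      l * shootingError C N θ s (l * R) := by
    intro s h0 h
    have hls : 0 ≤ l * s := mul_nonneg hl.le h0
    obtain ⟨⟨hc, -⟩, hψu⟩ := hψ (l * s) hls (hbound s h0 h)
    have hε : ∀ x ∈ Set.Icc (-R) R, |ψ (l * s) x - u x| ≤ solutionError C N s (l * R) := by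
      intro x hx
      refine (hψu x hx).trans ?_
      have b := D.integral_abs_add_sq_le hR hQ hN hl s
      calc 3 * C * R * (l * s) + (4 * C ^ 2 * R * ∫ t in (-R)..R, |l * Q t + (l * s) ^ 2|) *
            (2 * (C + l * s * (3 * C * R)))
          ≤ 3 * C * R * (l * s) + (4 * C ^ 2 * (l * R * (N + 2 * s ^ 2 * (l * R)))) *
            (2 * (C + l * s * (3 * C * R))) := by gcongr
        _ = solutionError C N s (l * R) := by
            unfold solutionError
            ring
    have hε0 : 0 ≤ solutionError C N s (l * R) := (abs_nonneg _).trans (hε R ⟨hab, le_rfl⟩)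
    have key := D.abs_shootingValue_sub_le hR hq hls hc hε
    have e1 : ∫ t in (-R)..R, |l * Q t| = l * ∫ t in (-R)..R, |Q t| := by
      rw [← intervalIntegral.integral_const_mul]
      refine intervalIntegral.integral_congr fun t _ => ?_
      rw [abs_mul, abs_of_pos hl]
    have e2 : ∫ t in (-R)..R, l * Q t * u t ^ 2 = l * ∫ t in (-R)..R, Q t * u t ^ 2 := by
      rw [← intervalIntegral.integral_const_mul]
      exact intervalIntegral.integral_congr fun t _ => mul_assoc _ _ _
    rw [e1, e2, mul_assoc l s, ← mul_add] at key
    refine key.trans ?_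
    calc _ ≤ C * solutionError C N s (l * R) * (l * N) +
          (l * s) ^ 2 * (C * (C + solutionError C N s (l * R)) * (2 * R)) +
          l * (s * |θ|) * solutionError C N s (l * R) := by
            rw [mul_assoc l s |θ|]
            gcongr
      _ = l * shootingError C N θ s (l * R) := by
          unfold shootingError
          ring
  have hle : l * s₁ ≤ l * s₂ := mul_le_mul_of_nonneg_left hs hl.le
  have hsub : Set.Icc (l * s₁) (l * s₂) ⊆
      {κ | 4 * C ^ 2 * R * ∫ t in (-R)..R, |l * Q t + κ ^ 2| ≤ 1 / 2} := by
    intro κ hκ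
    have e : κ = l * (κ / l) := by field_simp
    have a1 : s₁ ≤ κ / l := by rw [le_div_iff₀ hl]; linarith [hκ.1]
    have a2 : κ / l ≤ s₂ := by rw [div_le_iff₀ hl]; linarith [hκ.2]
    have := hbound (κ / l) (hs₁.le.trans a1) a2
    rwa [← e] at this
  have n1 : shootingValue u (fun x => l * Q x) θ R (l * s₁) (ψ (l * s₁)) ≤ 0 := by
    have := (abs_le.1 (hexp s₁ hs₁.le hs)).2
    have h := mul_neg_of_pos_of_neg hl h₁
    nlinarith
  have n2 : 0 ≤ shootingValue u (fun x => l * Q x) θ R (l * s₂) (ψ (l * s₂)) := by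
    have := (abs_le.1 (hexp s₂ (hs₁.le.trans hs) le_rfl)).1
    have h := mul_pos hl h₂
    nlinarith
  obtain ⟨κ, hκ, hκ0⟩ := intermediate_value_Icc hle (hcont.mono hsub) ⟨n1, n2⟩
  have hκpos : 0 < κ := (mul_pos hl hs₁).trans_le hκ.1
  have e : κ = l * (κ / l) := by field_simp
  refine ⟨κ / l, ⟨by rw [le_div_iff₀ hl]; linarith [hκ.1],
    by rw [div_le_iff₀ hl]; linarith [hκ.2]⟩, ?_⟩
  rw [← e]
  exact D.isEigenvalue_of_shootingValue_eq_zero hR hq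
    (fun x hx => by rw [hQR x hx, mul_zero]) hW hκpos (hψ κ hκpos.le (hsub hκ)).1 hκ0

end IsResonantSystem

/-! ### The threshold eigenvalue -/

theorem exists_radius_of_hasCompactSupport {f : ℝ → ℝ} (hf : HasCompactSupport f) :
    ∃ r, 0 < r ∧ ∀ x, r ≤ |x| → f x = 0 := by
  obtain ⟨M, hM⟩ := hf.isCompact.isBounded.subset_closedBall 0
  refine ⟨max M 0 + 1, by positivity, fun x hx => ?_⟩
  by_contra h0
  have := hM (subset_tsupport _ h0)
  rw [Metric.mem_closedBall, dist_zero_right, Real.norm_eq_abs] at this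
  linarith [le_max_left M 0]

theorem integrable_of_memLp_top {f : ℝ → ℝ} (hf : MemLp f ⊤ volume) (hc : HasCompactSupport f) :
    Integrable f := by
  have : IsFiniteMeasure (volume.restrict (tsupport f)) :=
    ⟨by simpa using hc.isCompact.measure_lt_top⟩
  have h := (hf.restrict (tsupport f)).integrable le_top
  exact (integrableOn_iff_integrable_of_support_subset (subset_tsupport f)).1 h

theorem memLp_top_comp_mul_left {f : ℝ → ℝ} (hf : MemLp f ⊤ volume) {a : ℝ} (ha : a ≠ 0) :
    MemLp (fun x => f (a * x)) ⊤ volume := by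
  refine MemLp.comp_of_map (f := fun x => a * x) ?_ (by fun_prop)
  rw [Real.map_volume_mul_left ha]
  exact hf.smul_measure ENNReal.ofReal_ne_top

theorem integral_mul_comp_mul_left (f g : ℝ → ℝ) {a : ℝ} (ha : 0 < a) :
    ∫ x, a * f (a * x) * g x = ∫ y, f y * g (y / a) := by
  have h := Measure.integral_comp_mul_left (fun y => f y * g (y / a)) a
  simp only [mul_div_cancel_left₀ _ ha.ne'] at h
  simp only [mul_assoc]
  rw [integral_const_mul, h, smul_eq_mul, abs_of_pos (inv_pos.2 ha), mul_inv_cancel_left₀ ha.ne']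

theorem intervalIntegral_eq_integral_of_support {f : ℝ → ℝ} {R : ℝ}
    (hf : ∀ x, R ≤ |x| → f x = 0) : ∫ x in (-R)..R, f x = ∫ x, f x := by
  refine intervalIntegral.integral_eq_integral_of_support_subset fun x hx => ?_
  have h : |x| < R := lt_of_not_ge fun h => hx (hf x h)
  exact ⟨(abs_lt.1 h).1, (abs_lt.1 h).2.le⟩

/-- Approximate solutions to a parametrized problem, eventually available for every tolerance, can
be assembled into one convergent branch. The parameter itself provides the slack with which the
distance to the limit is almost minimized. -/
theorem exists_tendsto_branch {P : ℝ → ℝ → Prop} {k : ℝ}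
    (h : ∀ η > 0, ∀ᶠ l in 𝓝[>] (0 : ℝ), ∃ s, P l s ∧ |s - k| ≤ η) :
    ∃ s : ℝ → ℝ, Tendsto s (𝓝[>] 0) (𝓝 k) ∧ ∀ᶠ l in 𝓝[>] (0 : ℝ), P l (s l) := by
  let S : ℝ → Set ℝ := fun l => {d | ∃ s, P l s ∧ |s - k| = d}
  have hS : ∀ l, BddBelow (S l) := fun l => ⟨0, by
    rintro d ⟨s, -, rfl⟩
    exact abs_nonneg _⟩
  have hch : ∀ l, ∃ s, 0 < l → (S l).Nonempty → P l s ∧ |s - k| < sInf (S l) + l := by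
    intro l
    by_cases hl : 0 < l ∧ (S l).Nonempty
    · obtain ⟨d, ⟨s, hs, rfl⟩, hd⟩ := Real.lt_sInf_add_pos hl.2 hl.1
      exact ⟨s, fun _ _ => ⟨hs, hd⟩⟩
    · exact ⟨0, fun h1 h2 => absurd ⟨h1, h2⟩ hl⟩
  choose s hs using hch
  have hpos : ∀ᶠ l in 𝓝[>] (0 : ℝ), 0 < l := eventually_mem_nhdsWithin
  refine ⟨s, ?_, ?_⟩
  · rw [Metric.tendsto_nhds]
    intro ε hε
    have hlt : ∀ᶠ l in 𝓝[>] (0 : ℝ), l < ε / 2 :=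
      mem_nhdsWithin_of_mem_nhds (Iio_mem_nhds (by linarith))
    filter_upwards [hpos, hlt, h (ε / 2) (by linarith)] with l h0 h1 ⟨t, ht, htk⟩
    have hmem : |t - k| ∈ S l := ⟨t, ht, rfl⟩
    have := (hs l h0 ⟨_, hmem⟩).2
    have := csInf_le (hS l) hmem
    rw [Real.dist_eq]
    linarith
  · filter_upwards [hpos, h 1 one_pos] with l h0 ⟨t, ht, _⟩
    exact (hs l h0 ⟨_, t, ht, rfl⟩).1

theorem exists_thresholdEigenvalue_of_branch {H : ℝ → L2 →ₗ.[ℂ] L2} {k K : ℝ} (hk : 0 < k)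
    (hK : K ^ 2 = k ^ 2)
    (h : ∀ η > 0, ∀ᶠ l in 𝓝[>] (0 : ℝ), ∃ s,
      IsEigenvalue (H l) ((-(l * s) ^ 2 : ℝ) : ℂ) ∧ |s - k| ≤ η) :
    ∃ e : ℝ → ℝ, IsThresholdEigenvalue H e ∧ HasThresholdAsymptotics e K := by
  obtain ⟨s, hs, hP⟩ := exists_tendsto_branch h
  have hpos : ∀ᶠ l in 𝓝[>] (0 : ℝ), 0 < l := eventually_mem_nhdsWithin
  have hl0 : Tendsto (fun l : ℝ => l) (𝓝[>] 0) (𝓝 0) := nhdsWithin_le_nhds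
  refine ⟨fun l => -(l * s l) ^ 2, ⟨?_, ?_⟩, fun l => s l ^ 2 - k ^ 2, ?_, ?_⟩
  · filter_upwards [hP, hpos, hs.eventually_const_lt hk] with l h1 h2 h3
    have h4 := mul_pos h2 h3
    exact ⟨neg_neg_of_pos (by positivity), h1⟩
  · simpa using ((hl0.mul hs).pow 2).neg
  · exact tendsto_sub_nhds_zero_iff.2 (hs.pow 2)
  · refine Eventually.of_forall fun l => ?_
    rw [hK]
    ring

/-- The common core of the three regimes: since `λ/α → 0`, the perturbed solution follows the
half-bound state over the whole support of the perturbation, and only the limit of the first-order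
integral matters. -/
theorem exists_thresholdEigenvalue {U V α u : ℝ → ℝ} {θ L : ℝ}
    (hU : MemLp U ⊤ volume) (hUc : HasCompactSupport U)
    (hV : MemLp V ⊤ volume) (hVc : HasCompactSupport V) (hα : ∀ l, 0 < l → 0 < α l)
    (hu : IsNormalizedHalfBoundState U u) (hθ : Tendsto u atTop (𝓝 θ))
    (hlα : Tendsto (fun l => l / α l) (𝓝[>] 0) (𝓝 0)) (hL : L < 0)
    (hI : Tendsto (fun l => ∫ y, V y * u (y / α l) ^ 2) (𝓝[>] 0) (𝓝 L)) :
    ∃ e : ℝ → ℝ, IsThresholdEigenvalue (hamiltonian U V α) e ∧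
      HasThresholdAsymptotics e (L / (θ ^ 2 + 1)) := by
  obtain ⟨r, hr, hUr⟩ := exists_radius_of_hasCompactSupport hUc
  obtain ⟨ρ, hρ, hVρ⟩ := exists_radius_of_hasCompactSupport hVc
  obtain ⟨u', v, v', C, D⟩ :=
    hu.exists_resonantSystem hθ (integrable_of_memLp_top hU hUc).locallyIntegrable hr hUr
  have hθ1 : 0 < 1 + θ ^ 2 := by positivity
  have hkp : 0 < -L / (1 + θ ^ 2) := div_pos (by linarith) hθ1
  set k := -L / (1 + θ ^ 2) with hk
  have hkL : k * (1 + θ ^ 2) = -L := div_mul_cancel₀ _ hθ1.ne'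
  set N := ∫ y, |V y|
  have hpos : ∀ᶠ l in 𝓝[>] (0 : ℝ), 0 < l := eventually_mem_nhdsWithin
  have hl0 : Tendsto (fun l : ℝ => l) (𝓝[>] 0) (𝓝 0) := nhdsWithin_le_nhds
  have hδ : Tendsto (fun l => l * (r + ρ / α l)) (𝓝[>] 0) (𝓝 0) := by
    have h1 := (hl0.mul_const r).add (hlα.mul_const ρ)
    simp only [zero_mul, add_zero] at h1
    refine h1.congr fun l => ?_
    ring
  refine exists_thresholdEigenvalue_of_branch hkp (by rw [hk]; ring) fun η hη => ?_
  -- The lower endpoint `s₁` has to stay positive.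
  obtain ⟨τ, hτ0, hτη, hτk⟩ : ∃ τ, 0 < τ ∧ τ ≤ η ∧ τ < k :=
    ⟨min η (k / 2), lt_min hη (by linarith), min_le_left _ _,
      (min_le_right _ _).trans_lt (by linarith)⟩
  have t1 := ((hI.const_add ((k - τ) * (1 + θ ^ 2))).add
    ((tendsto_shootingError C N θ (k - τ)).comp hδ)).eventually_lt_const
    (u := 0) (by nlinarith)
  have t2 := ((hI.const_add ((k + τ) * (1 + θ ^ 2))).sub
    ((tendsto_shootingError C N θ (k + τ)).comp hδ)).eventually_const_lt
    (u := 0) (by nlinarith)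
  have t3 : ∀ᶠ l in 𝓝[>] (0 : ℝ), 4 * C ^ 2 * (l * (r + ρ / α l) *
      (N + 2 * (k + τ) ^ 2 * (l * (r + ρ / α l)))) < 1 / 2 := by
    have hc : Continuous fun δ : ℝ => 4 * C ^ 2 * (δ * (N + 2 * (k + τ) ^ 2 * δ)) := by fun_prop
    have := (hc.tendsto 0).comp hδ
    exact this.eventually_lt_const (by norm_num)
  filter_upwards [hpos, t1, t2, t3] with l hl h1 h2 h3
  have ha := hα l hl
  have hR : r ≤ r + ρ / α l := le_add_of_nonneg_right (div_pos hρ ha).le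
  have hQR : ∀ x, r + ρ / α l ≤ |x| → α l * V (α l * x) = 0 := by
    intro x hx
    rw [hVρ (α l * x), mul_zero]
    rw [abs_mul, abs_of_pos ha]
    have := mul_le_mul_of_nonneg_left hx ha.le
    rw [mul_add, mul_div_cancel₀ _ ha.ne'] at this
    nlinarith
  have hQ : LocallyIntegrable fun x => α l * V (α l * x) :=
    (((integrable_of_memLp_top hV hVc).comp_mul_left' ha.ne').const_mul _).locallyIntegrable
  have hQI : ∫ t in (-(r + ρ / α l))..(r + ρ / α l), α l * V (α l * t) * u t ^ 2 =
      ∫ y, V y * u (y / α l) ^ 2 := by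
    rw [intervalIntegral_eq_integral_of_support fun x hx => by rw [hQR x hx, zero_mul]]
    exact integral_mul_comp_mul_left V (fun x => u x ^ 2) ha
  have hQN : ∫ t in (-(r + ρ / α l))..(r + ρ / α l), |α l * V (α l * t)| ≤ N := by
    rw [intervalIntegral_eq_integral_of_support fun x hx => by rw [hQR x hx, abs_zero]]
    have := integral_mul_comp_mul_left (fun x => |V x|) (fun _ => 1) ha
    simp only [mul_one] at this
    simp only [abs_mul, abs_of_pos ha, this]
    exact le_rfl
  have hW : MemLp (fun x => U x + l * (α l * V (α l * x))) ⊤ volume :=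
    hU.add (((memLp_top_comp_mul_left hV ha.ne').const_mul (α l)).const_mul l)
  obtain ⟨s, hs, he⟩ := D.exists_eigenvalue_between hR hQ hQR hQN hl hW (s₁ := k - τ)
    (s₂ := k + τ) (by linarith) (by linarith) h3.le (by rw [hQI]; exact h1)
    (by rw [hQI]; exact h2)
  have hH : hamiltonian U V α l = schrodinger fun x => U x + l * (α l * V (α l * x)) := by
    simp only [hamiltonian, mul_assoc]
  refine ⟨s, hH ▸ he, abs_le.2 ⟨by linarith [hs.1], by linarith [hs.2]⟩⟩

/-- Dominated convergence for the first-order integral; the three regimes differ only in the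
pointwise limit `G` of the rescaled half-bound state. -/
theorem tendsto_integral_mul_sq {V u α G : ℝ → ℝ} {C : ℝ} {l : Filter ℝ} [l.IsCountablyGenerated]
    (hV : Integrable V) (hu : Continuous u) (hC : ∀ x, |u x| ≤ C)
    (hG : ∀ᵐ y, Tendsto (fun t => u (y / α t)) l (𝓝 (G y))) :
    Tendsto (fun t => ∫ y, V y * u (y / α t) ^ 2) l (𝓝 (∫ y, V y * G y ^ 2)) := by
  refine tendsto_integral_filter_of_dominated_convergence (fun y => |V y| * C ^ 2)
    (Eventually.of_forall fun t => ?_) (Eventually.of_forall fun t => Eventually.of_forall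
      fun y => ?_) (hV.abs.mul_const _) (hG.mono fun y hy => (hy.pow 2).const_mul _)
  · have h : Continuous fun y => u (y / α t) ^ 2 := by fun_prop
    exact hV.aestronglyMeasurable.mul h.aestronglyMeasurable
  · rw [norm_mul, norm_pow, Real.norm_eq_abs, Real.norm_eq_abs]
    have := hC (y / α t)
    gcongr

theorem integral_mul_ite_sq {V : ℝ → ℝ} (hV : Integrable V) (θ : ℝ) :
    ∫ y, V y * (if y < 0 then 1 else θ) ^ 2 =
      (∫ x in Set.Iio 0, V x) + θ ^ 2 * (∫ x in Set.Ioi 0, V x) := by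
  have hi : Integrable fun y => V y * (if y < 0 then 1 else θ) ^ 2 := by
    refine hV.mul_bdd (c := max 1 (θ ^ 2)) ?_ (Eventually.of_forall fun y => ?_)
    · refine Measurable.aestronglyMeasurable ?_
      exact (Measurable.ite measurableSet_Iio measurable_const measurable_const).pow_const 2
    · split_ifs
      · simp
      · rw [Real.norm_eq_abs, abs_of_nonneg (sq_nonneg _)]
        exact le_max_right _ _
  rw [← integral_add_compl measurableSet_Iio hi, Set.compl_Iio, integral_Ici_eq_integral_Ioi]
  congr 1
  · refine setIntegral_congr_fun measurableSet_Iio fun y hy => ?_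
    rw [Set.mem_Iio] at hy
    simp [hy]
  · rw [← integral_const_mul]
    refine setIntegral_congr_fun measurableSet_Ioi fun y hy => ?_
    rw [Set.mem_Ioi] at hy
    simp only [if_neg hy.not_gt]
    ring

end Threshold

theorem theorem1 (U V : ℝ → ℝ)
    (hU : MemLp U ⊤ volume) (hUc : HasCompactSupport U)
    (hV : MemLp V ⊤ volume) (hVc : HasCompactSupport V)
    (α : ℝ → ℝ) (hα : ∀ l, 0 < l → 0 < α l)
    (u : ℝ → ℝ) (hu : Threshold.IsNormalizedHalfBoundState U u)
    (θ : ℝ) (hθ : Tendsto u atTop (𝓝 θ)) :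
    (∀ a : ℝ, 0 < a → Tendsto α (𝓝[>] 0) (𝓝 a) → (∫ x, V (a * x) * u x ^ 2) < 0 →
      ∃ e : ℝ → ℝ, Threshold.IsThresholdEigenvalue (Threshold.hamiltonian U V α) e ∧
        Threshold.HasThresholdAsymptotics e (a / (θ ^ 2 + 1) * ∫ x, V (a * x) * u x ^ 2)) ∧
    (Tendsto α (𝓝[>] 0) atTop → u 0 ≠ 0 → (∫ x, V x) < 0 →
      ∃ e : ℝ → ℝ, Threshold.IsThresholdEigenvalue (Threshold.hamiltonian U V α) e ∧
        Threshold.HasThresholdAsymptotics e (u 0 ^ 2 / (θ ^ 2 + 1) * ∫ x, V x)) ∧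
    (Tendsto α (𝓝[>] 0) (𝓝 0) → Tendsto (fun l => l / α l) (𝓝[>] 0) (𝓝 0) →
      (∫ x in Set.Iio 0, V x) + θ ^ 2 * (∫ x in Set.Ioi 0, V x) < 0 →
      ∃ e : ℝ → ℝ, Threshold.IsThresholdEigenvalue (Threshold.hamiltonian U V α) e ∧
        Threshold.HasThresholdAsymptotics e
          (1 / (θ ^ 2 + 1) * (∫ x in Set.Iio 0, V x) +
            θ ^ 2 / (θ ^ 2 + 1) * (∫ x in Set.Ioi 0, V x))) := by
  have hVi := Threshold.integrable_of_memLp_top hV hVc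
  have huc : Continuous u := hu.1.1.1.continuous
  obtain ⟨C, hC⟩ := hu.1.2.2
  have hl0 : Tendsto (fun l : ℝ => l) (𝓝[>] 0) (𝓝 0) := nhdsWithin_le_nhds
  have core := fun (L : ℝ) => Threshold.exists_thresholdEigenvalue (L := L)
    hU hUc hV hVc hα hu hθ
  refine ⟨fun a ha hlim hneg => ?_, fun hlim hu0 hneg => ?_, fun hlim hlα hneg => ?_⟩
  · have e := Threshold.integral_mul_comp_mul_left V (fun x => u x ^ 2) ha
    simp only [mul_assoc] at e
    rw [integral_const_mul] at e
    have hI := Threshold.tendsto_integral_mul_sq (G := fun y => u (y / a)) (α := α)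
      (l := 𝓝[>] 0) hVi huc hC (Eventually.of_forall fun y =>
        (huc.tendsto _).comp (tendsto_const_nhds.div hlim ha.ne'))
    rw [← e] at hI
    have hlα : Tendsto (fun l => l / α l) (𝓝[>] 0) (𝓝 0) := by
      simpa only [zero_div] using! hl0.div hlim ha.ne'
    have := core _ hlα (mul_neg_of_pos_of_neg ha hneg) hI
    rwa [mul_div_right_comm] at this
  · have hI := Threshold.tendsto_integral_mul_sq (G := fun _ => u 0) (α := α)
      (l := 𝓝[>] 0) hVi huc hC (Eventually.of_forall fun y =>
        (huc.tendsto _).comp (hlim.const_div_atTop y))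
    rw [integral_mul_const, mul_comm] at hI
    have := core _ (hl0.div_atTop hlim) (mul_neg_of_pos_of_neg (by positivity) hneg) hI
    rwa [mul_div_right_comm] at this
  · have hinv : Tendsto (fun l => (α l)⁻¹) (𝓝[>] 0) atTop := by
      refine tendsto_inv_nhdsGT_zero.comp (tendsto_nhdsWithin_iff.2 ⟨hlim, ?_⟩)
      filter_upwards [eventually_mem_nhdsWithin] with l hl using hα l hl
    have hne : ∀ᵐ y : ℝ, y ≠ 0 := by simp [ae_iff]
    have hI := Threshold.tendsto_integral_mul_sq (G := fun y => if y < 0 then 1 else θ) (α := α)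
      (l := 𝓝[>] 0) hVi huc hC (by
        filter_upwards [hne] with y hy
        rcases lt_or_gt_of_ne hy with h | h
        · simp only [if_pos h, div_eq_mul_inv]
          exact hu.2.comp (hinv.const_mul_atTop_of_neg h)
        · simp only [if_neg h.not_gt, div_eq_mul_inv]
          exact hθ.comp (hinv.const_mul_atTop h))
    rw [Threshold.integral_mul_ite_sq hVi] at hI
    have := core _ hlα hneg hI
    rwa [show ((∫ x in Set.Iio 0, V x) + θ ^ 2 * (∫ x in Set.Ioi 0, V x)) / (θ ^ 2 + 1) =
      1 / (θ ^ 2 + 1) * (∫ x in Set.Iio 0, V x) +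
        θ ^ 2 / (θ ^ 2 + 1) * (∫ x in Set.Ioi 0, V x) by ring] at this
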